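/- Let $\mathcal M$ be a smooth finite-dimensional Riemannian manifold without boundary, and let $\mathrm R\colon \mathrm T\mathcal M\to\mathcal M$, $(x,s)\mapsto \mathrm R_x(s)$, be a retraction: a smooth map with $\mathrm R_x(0)=x$ and $\mathrm D\mathrm R_x(0)=\mathrm{id}$. Let $f\colon\mathcal M\to\mathbb R$ be twice continuously differentiable with $f\ge f_{\mathrm{low}}$ for some $f_{\mathrm{low}}\in\mathbb R$. For $x\in\mathcal M$ put $\hat f_x=f\circ \mathrm R_x\colon \mathrm T_x\mathcal M\to\mathbb R$; $\nabla,\nabla^2$ denote the Euclidean gradient and Hessian operators on tangent spaces, $\mathrm{grad} f,\mathrm{Hess} f$ the Riemannian ones. **Algorithm (ARC with second-order progress).** Parameters $\theta>0$, $\varsigma_{\min}>0$, $0<\eta_1\le\eta_2<1$, $0<\gamma_1<1<\gamma_2<\gamma_3$; input $x_0\in\mathcal M$, $\varsigma_0\ge\varsigma_{\min}$. At iteration $k=0,1,2,\dots$, with $\hat f_k=\hat f_{x_k}$, let $$m_k(s)=\hat f_k(0)+\langle s,\nabla\hat f_k(0)\rangle+\tfrac12\langle s,\nabla^2\hat f_k(0)[s]\rangle+\tfrac{\varsigma_k}{3}\|s\|^3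 ,$$ and choose any $s_k\in \mathrm T_{x_k}\mathcal M$ with $m_k(s_k)\le m_k(0)$, $\|\nabla m_k(s_k)\|\le\theta\|s_k\|^2$ and $\lambda_{\min}(\nabla^2m_k(s_k))\ge-\theta\|s_k\|$. If $s_k=0$, terminate. Otherwise let $$\rho_k=\frac{f(x_k)-f(\mathrm R_{x_k}(s_k))}{m_k(0)-m_k(s_k)+\frac{\varsigma_k}3\|s_k\|^3}.$$ If $\rho_k\ge\eta_1$ (a *successful* iteration) set $x_{k+1}=\mathrm R_{x_k}(s_k)$, otherwise $x_{k+1}=x_k$. Choose any $\varsigma_{k+1}$ in $[\max(\varsigma_{\min},\gamma_1\varsigma_k),\varsigma_k]$ if $\rho_k\ge\eta_2$, in $[\varsigma_k,\gamma_2\varsigma_k]$ if $\eta_1\le\rho_k<\eta_2$, and in $[\gamma_2\varsigma_k,\gamma_3\varsigma_k]$ if $\rho_k<\eta_1$. **Statement.** Consider any run of the algorithm from an arbitrary $x_0$, and let $\varepsilon_g,\varepsilon_H>0$. Assume that there is a constant $L$ such that at every iteration $k$ $$\hat f_k(s_k)-\Big[\hat f_k(0)+\langle s_k,\nabla\hat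 f_k(0)\rangle+\tfrac12\langle s_k,\nabla^2\hat f_k(0)[s_k]\rangle\Big]\le\tfrac L6\|s_k\|^3 .$$ Set $\varsigma_{\max}=\max\big(\varsigma_0,\frac{L\gamma_3}{2(1-\eta_2)}\big)$ and $$K_2(\varepsilon)=\frac{3(f(x_0)-f_{\mathrm{low}})}{\eta_1\varsigma_{\min}}\,(\theta+2\varsigma_{\max})^3\,\frac1{\varepsilon^3}.$$ Suppose that one of the following holds. (a) $\mathcal M$ is complete, $\mathrm R=\mathrm{Exp}$ is the exponential map, and for some $L'\ge0$, at every successful iteration, $$\big\|P_{s_k}^{-1}\mathrm{grad} f(\mathrm{Exp}_{x_k}(s_k))-\mathrm{grad} f(x_k)-\mathrm{Hess} f(x_k)[s_k]\big\|\le\tfrac{L'}2\|s_k\|^2,$$ where $P_{s_k}$ is parallel transport along $t\mapsto\mathrm{Exp}_{x_k}(ts_k)$ from $t=0$ to $t=1$. In this case put $$K_1(\varepsilon)=\frac{3(f(x_0)-f_{\mathrm{low}})}{\eta_1\varsigma_{\min}}\Big(\tfrac{L'}2+\theta+\varsigma_{\max}\Big)^{1.5}\frac1{\varepsilon^{1.5}}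 .$$ (b) $\mathrm R$ is second order (each curve $t\mapsto \mathrm R_x(ts)$ has zero intrinsic acceleration at $t=0$); for some $L'\ge0$ and some continuous $q\colon[0,\infty)\to[0,\infty)$ with $q(0)=0$, at every successful iteration, $$\big\|\nabla\hat f_k(s_k)-\nabla\hat f_k(0)-\nabla^2\hat f_k(0)[s_k]\big\|\le\tfrac{L'}2\|s_k\|^2+q(\|s_k\|)\,\|\mathrm{grad} f(\mathrm R_{x_k}(s_k))\| ;$$ and for some $a\in(0,\infty]$, $b>0$, at every successful iteration with $\|s_k\|\le a$, the smallest singular value of $\mathrm D\mathrm R_{x_k}(s_k)$ is at least $b$. In this case let $r$ be any real number with $0<r\le a$, $q(r)<b$ and $q(t)\le q(r)$ for all $t\in[0,r]$ (the last condition is automatic if $q$ is nondecreasing), and put $$K_1(\varepsilon)=\frac{3(f(x_0)-f_{\mathrm{low}})}{\eta_1\varsigma_{\min}}\max\left(\Big(\frac{\frac{L'}2+\theta+\varsigma_{\max}}{b-q(r)}\Big)^{1.5}\frac1{\varepsilon^{1.5}},\ \frac1{r^3}\right).$$ Then the run produces a point $x_k$ with $f(x_k)\le f(x_0)$, $\|\mathrm{grad}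 f(x_k)\|\le\varepsilon_g$ and $\lambda_{\min}(\mathrm{Hess} f(x_k))\ge-\varepsilon_H$ for some $$k\le\Big(1+\frac{|\log\gamma_1|}{\log\gamma_2}\Big)\big(K_1(\varepsilon_g)+K_2(\varepsilon_H)+1\big)+\frac1{\log\gamma_2}\log\Big(\frac{\varsigma_{\max}}{\varsigma_0}\Big)+1 .$$ -/

import Mathlib

open scoped Manifold ContDiff Topology NNReal ENNReal InnerProductSpace

noncomputable section

/-! ## Calculus and spectral notions on a Euclidean space -/

section Euclidean

variable {V : Type*} [NormedAddCommGroup V] [InnerProductSpace ℝ V] [CompleteSpace V]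

/-- The Hessian operator `∇²g(s)` of a real function on a Euclidean space: the derivative of its
gradient vector field. -/
def hessian (g : V → ℝ) (s : V) : V →L[ℝ] V :=
  fderiv ℝ (gradient g) s

/-- The smallest eigenvalue of a (symmetric) operator. -/
def lambdaMin {V : Type*} [AddCommGroup V] [Module ℝ V] (A : V →ₗ[ℝ] V) : ℝ :=
  sInf {μ : ℝ | Module.End.HasEigenvalue A μ}

/-- The smallest singular value of a linear map; Mathlib lists the singular values of a map on an
`n`-dimensional space in descending order, with indices `0, …, n - 1`. -/
def sigmaMin {V W : Type*} [NormedAddCommGroup V] [InnerProductSpace ℝ V] [FiniteDimensional ℝ V]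
    [NormedAddCommGroup W] [InnerProductSpace ℝ W] [FiniteDimensional ℝ W] (A : V →ₗ[ℝ] W) : ℝ :=
  A.singularValues (Module.finrank ℝ V - 1)

/-- Second-order Taylor expansion of `g` around `0`, evaluated at `s`. -/
def taylorTwo (g : V → ℝ) (s : V) : ℝ :=
  g 0 + ⟪s, gradient g 0⟫_ℝ + 1 / 2 * ⟪s, hessian g 0 s⟫_ℝ

/-- The cubically regularized model of `g` around `0`, with regularization parameter `ς`. -/
def cubicModel (g : V → ℝ) (ς : ℝ) (s : V) : ℝ :=
  taylorTwo g s + ς / 3 * ‖s‖ ^ 3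

end Euclidean

section Christoffel

variable {E : Type*} [NormedAddCommGroup E] [NormedSpace ℝ E]

/-- The Christoffel symbols of the first kind of a metric `g` (given by bilinear forms `g y` on `E`)
at the point `y`: `w ↦ 1/2 (∂_u g(v, w) + ∂_v g(u, w) - ∂_w g(u, v))`. Here `fderiv ℝ g y w u v` is
`∂_w g(u, v)`. -/
def christoffelFirst (g : E → E →L[ℝ] E →L[ℝ] ℝ) (y u v : E) : E →L[ℝ] ℝ :=
  (1 / 2 : ℝ) • (fderiv ℝ g y u v + fderiv ℝ g y v u - ((fderiv ℝ g y).flip u).flip v)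

lemma christoffelFirst_add (g : E → E →L[ℝ] E →L[ℝ] ℝ) (y u u' v : E) :
    christoffelFirst g y (u + u') v = christoffelFirst g y u v + christoffelFirst g y u' v := by
  ext w
  simp [christoffelFirst]
  ring

lemma christoffelFirst_smul (g : E → E →L[ℝ] E →L[ℝ] ℝ) (y : E) (c : ℝ) (u v : E) :
    christoffelFirst g y (c • u) v = c • christoffelFirst g y u v := by
  ext w
  simp [christoffelFirst]
  ring

end Christoffel

/-! ## Riemannian geometry -/

open Bundle

section Riemannian

variable {E : Type*} [NormedAddCommGroup E] [NormedSpace ℝ E] [FiniteDimensional ℝ E]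
  {H : Type*} [TopologicalSpace H] {I : ModelWithCorners ℝ E H}
  {M : Type*} [TopologicalSpace M] [ChartedSpace H M]

instance instFiniteDimensionalTangentSpace (x : M) : FiniteDimensional ℝ (TangentSpace I x) :=
  inferInstanceAs (FiniteDimensional ℝ E)

variable [RiemannianBundle (fun x : M => TangentSpace I x)]

instance instCompleteTangentSpace (x : M) : CompleteSpace (TangentSpace I x) :=
  FiniteDimensional.complete ℝ (TangentSpace I x)

variable (I) in
/-- The Riemannian gradient: `Df(x)[s] = ⟪grad f(x), s⟫`. -/
def grad (f : M → ℝ) (x : M) : TangentSpace I x :=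
  (InnerProductSpace.toDual ℝ (TangentSpace I x)).symm (mvfderiv I f x)

variable [IsManifold I 1 M]

variable (I) in
/-- Components, in the chart around `p`, of the tangent vector `v` at `q`. -/
def toCoord (p q : M) : TangentSpace I q →L[ℝ] E :=
  (trivializationAt E (TangentSpace I : M → Type _) p).continuousLinearMapAt ℝ q

variable (I) in
/-- The tangent vector at `q` with given components in the chart around `p`. -/
def ofCoord (p q : M) : E →L[ℝ] TangentSpace I q :=
  (trivializationAt E (TangentSpace I : M → Type _) p).symmL ℝ q

variable (I) in
/-- The Riemannian metric in the chart around `p`: the matrix `g_{ij}(y)` as a bilinear form. -/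
def metricInChart (p : M) (y : E) : E →L[ℝ] E →L[ℝ] ℝ :=
  (innerSL ℝ (E := TangentSpace I ((extChartAt I p).symm y))).bilinearComp
    (ofCoord I p ((extChartAt I p).symm y)) (ofCoord I p ((extChartAt I p).symm y))

variable (I) in
/-- The Christoffel symbols (of the second kind) at `p` in the chart around `p`, for the Riemannian
(Levi-Civita) connection: `⟪Γ(u, v), w⟫ = 1/2 (∂_u g(v, w) + ∂_v g(u, w) - ∂_w g(u, v))`. -/
def christoffel (p : M) (u v : TangentSpace I p) : TangentSpace I p :=
  (InnerProductSpace.toDual ℝ (TangentSpace I p)).symm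
    (christoffelFirst (metricInChart I p) (extChartAt I p p) (toCoord I p p u) (toCoord I p p v)
      ∘L toCoord I p p)

/-- The covariant derivative `u ↦ ∇_u X` at `x` of a vector field `X`, for the Riemannian
connection: in the chart around `x` it is `∂_u X + Γ(u, X)`. -/
def covDeriv (X : ∀ x : M, TangentSpace I x) (x : M) : TangentSpace I x →ₗ[ℝ] TangentSpace I x where
  toFun u := ofCoord I x x
      (fderiv ℝ (fun y : E => toCoord I x ((extChartAt I x).symm y) (X ((extChartAt I x).symm y)))
        (extChartAt I x x) (toCoord I x x u))
    + christoffel I x u (X x)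
  map_add' u v := by
    simp only [christoffel, map_add, christoffelFirst_add, ContinuousLinearMap.add_comp]
    abel
  map_smul' c u := by
    simp only [christoffel, map_smul, christoffelFirst_smul, ContinuousLinearMap.smul_comp,
      RingHom.id_apply, smul_add]

variable (I) in
/-- The Riemannian Hessian `Hess f = ∇ grad f`. -/
def Hess (f : M → ℝ) (x : M) : TangentSpace I x →ₗ[ℝ] TangentSpace I x :=
  covDeriv (grad I f) x

variable (I) in
/-- The velocity `c'(t)` of a curve. -/
def velocity (c : ℝ → M) (t : ℝ) : TangentSpace I (c t) :=
  mfderiv 𝓘(ℝ, ℝ) I c t ((NormedSpace.fromTangentSpace t).symm (1 : ℝ))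

/-- `D` is the covariant derivative at time `t`, relative to the set of times `S`, of the vector
field `Z` along the curve `c`. In the chart around `c t` it is `Z' + Γ(c', Z)`. -/
def HasCovDerivWithinAt (c : ℝ → M) (Z : ∀ t : ℝ, TangentSpace I (c t)) (S : Set ℝ) (t : ℝ)
    (D : TangentSpace I (c t)) : Prop :=
  ContinuousWithinAt c S t ∧ ∃ c' z' : E,
    HasDerivWithinAt (fun τ => extChartAt I (c t) (c τ)) c' S t ∧
    HasDerivWithinAt (fun τ => toCoord I (c t) (c τ) (Z τ)) z' S t ∧
    D = ofCoord I (c t) (c t) z' + christoffel I (c t) (ofCoord I (c t) (c t) c') (Z t)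

variable (I) in
/-- Geodesics: smooth curves with zero intrinsic acceleration. -/
def IsGeodesic (c : ℝ → M) : Prop :=
  ContMDiff 𝓘(ℝ, ℝ) I ∞ c ∧ ∀ t, HasCovDerivWithinAt c (velocity I c) Set.univ t 0

/-- Parallel transport along `c|_[0,1]` takes the tangent vector `v` at `c 0` to the tangent vector
`w` at `c 1`: they are the end values of a parallel vector field along `c|_[0,1]`. -/
def IsParallelTransport (c : ℝ → M) (v w : TangentBundle I M) : Prop :=
  ∃ Z : ∀ t : ℝ, TangentSpace I (c t),
    (∀ t ∈ Set.Icc (0 : ℝ) 1, HasCovDerivWithinAt c Z (Set.Icc 0 1) t 0) ∧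
    (⟨c 0, Z 0⟩ : TangentBundle I M) = v ∧ (⟨c 1, Z 1⟩ : TangentBundle I M) = w

/-- The differential `DR_x(s) : T_x M → T_{R_x(s)} M` of `R_x`. -/
def fiberDeriv (R : TangentBundle I M → M) (x : M) (s : TangentSpace I x) :
    TangentSpace I x →L[ℝ] TangentSpace I (R ⟨x, s⟩) :=
  (mfderiv 𝓘(ℝ, TangentSpace I x) I (fun v : TangentSpace I x => R ⟨x, v⟩) s) ∘L
    ((NormedSpace.fromTangentSpace (𝕜 := ℝ) s).symm : TangentSpace I x →L[ℝ] _)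

/-- A retraction: a smooth map `R : TM → M` with `R_x(0) = x` and `DR_x(0) = id`. The two
conditions are given as the single equality `(R_x(0), DR_x(0)[v]) = (x, v)` in `TM`. -/
structure IsRetraction (R : TangentBundle I M → M) : Prop where
  smooth : ContMDiff I.tangent I ∞ R
  base : ∀ (x : M) (v : TangentSpace I x),
    (⟨R ⟨x, 0⟩, fiberDeriv R x 0 v⟩ : TangentBundle I M) = ⟨x, v⟩

/-- The retraction `R` is the exponential map: `t ↦ R_x(ts)` is the geodesic (defined for all times)
through `x` with velocity `s`. For a retraction, the initial conditions are automatic. A manifold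
has such an `R` only if it is (geodesically) complete. -/
def IsExponential (R : TangentBundle I M → M) : Prop :=
  ∀ (x : M) (s : TangentSpace I x), IsGeodesic I (fun t : ℝ => R ⟨x, t • s⟩)

/-- Second-order retractions: the curves `t ↦ R_x(ts)` have zero initial acceleration. -/
def IsSecondOrder (R : TangentBundle I M → M) : Prop :=
  ∀ (x : M) (s : TangentSpace I x),
    HasCovDerivWithinAt (fun t : ℝ => R ⟨x, t • s⟩) (velocity I (fun t : ℝ => R ⟨x, t • s⟩))
      Set.univ 0 0

/-- The pullback `f ∘ R_x` of `f` to the tangent space at `x`. -/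
def pullback (f : M → ℝ) (R : TangentBundle I M → M) (x : M) : TangentSpace I x → ℝ :=
  fun s => f (R ⟨x, s⟩)

end Riemannian

/-! ## The algorithm -/

/-- Parameters of ARC, including the initial regularization parameter `ς₀`. -/
structure ARCParams where
  θ : ℝ
  ςmin : ℝ
  ς₀ : ℝ
  η₁ : ℝ
  η₂ : ℝ
  γ₁ : ℝ
  γ₂ : ℝ
  γ₃ : ℝ
  θ_pos : 0 < θ
  ςmin_pos : 0 < ςmin
  ςmin_le : ςmin ≤ ς₀
  η₁_pos : 0 < η₁
  η₁_le : η₁ ≤ η₂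
  η₂_lt : η₂ < 1
  γ₁_pos : 0 < γ₁
  γ₁_lt : γ₁ < 1
  γ₂_gt : 1 < γ₂
  γ₂_lt : γ₂ < γ₃

section Algorithm

variable {E : Type*} [NormedAddCommGroup E] [NormedSpace ℝ E] [FiniteDimensional ℝ E]
  {H : Type*} [TopologicalSpace H] {I : ModelWithCorners ℝ E H}
  {M : Type*} [TopologicalSpace M] [ChartedSpace H M]
  [RiemannianBundle (fun x : M => TangentSpace I x)] [IsManifold I 1 M]

variable (I M) in
/-- Iterates, trial steps and regularization parameters. -/
structure ARCSeq where
  x : ℕ → M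
  s : ∀ k, TangentSpace I (x k)
  ς : ℕ → ℝ

namespace ARCSeq

variable (Q : ARCSeq I M) (P : ARCParams) (f : M → ℝ) (R : TangentBundle I M → M)

/-- The algorithm gets to iteration `k` (and so produces `x k`): it has not terminated earlier. It
terminates at the first iteration with a zero step. -/
def Reached (k : ℕ) : Prop := ∀ j < k, Q.s j ≠ 0

/-- The model `m_k`. -/
def model (k : ℕ) : TangentSpace I (Q.x k) → ℝ :=
  cubicModel (pullback f R (Q.x k)) (Q.ς k)

/-- The regularized ratio `ρ_k`. -/
def rho (k : ℕ) : ℝ :=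
  (f (Q.x k) - f (R ⟨Q.x k, Q.s k⟩)) /
    (Q.model f R k 0 - Q.model f R k (Q.s k) + Q.ς k / 3 * ‖Q.s k‖ ^ 3)

/-- Iteration `k` takes place, does not terminate the algorithm, and is successful. -/
def Successful (k : ℕ) : Prop :=
  Q.Reached k ∧ Q.s k ≠ 0 ∧ P.η₁ ≤ Q.rho f R k

/-- `Q` is a run of ARC with second-order progress enforced, on `f`, with retraction `R`, from `x₀`.
Entries after termination are irrelevant and unconstrained. -/
structure IsRun (x₀ : M) : Prop where
  x_zero : Q.x 0 = x₀
  ς_zero : Q.ς 0 = P.ς₀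
  /-- First-order progress. -/
  decrease : ∀ k, Q.Reached k → Q.model f R k (Q.s k) ≤ Q.model f R k 0
  grad_le : ∀ k, Q.Reached k → ‖gradient (Q.model f R k) (Q.s k)‖ ≤ P.θ * ‖Q.s k‖ ^ 2
  /-- Second-order progress. -/
  hess_ge : ∀ k, Q.Reached k →
    -P.θ * ‖Q.s k‖ ≤ lambdaMin (hessian (Q.model f R k) (Q.s k)).toLinearMap
  /-- Acceptance or rejection of the trial step. -/
  accept : ∀ k, Q.Reached k → Q.s k ≠ 0 → P.η₁ ≤ Q.rho f R k → Q.x (k + 1) = R ⟨Q.x k, Q.s k⟩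
  reject : ∀ k, Q.Reached k → Q.s k ≠ 0 → Q.rho f R k < P.η₁ → Q.x (k + 1) = Q.x k
  /-- Update of the regularization parameter. -/
  very_successful : ∀ k, Q.Reached k → Q.s k ≠ 0 → P.η₂ ≤ Q.rho f R k →
    Q.ς (k + 1) ∈ Set.Icc (max P.ςmin (P.γ₁ * Q.ς k)) (Q.ς k)
  successful : ∀ k, Q.Reached k → Q.s k ≠ 0 → Q.rho f R k ∈ Set.Ico P.η₁ P.η₂ →
    Q.ς (k + 1) ∈ Set.Icc (Q.ς k) (P.γ₂ * Q.ς k)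
  unsuccessful : ∀ k, Q.Reached k → Q.s k ≠ 0 → Q.rho f R k < P.η₁ →
    Q.ς (k + 1) ∈ Set.Icc (P.γ₂ * Q.ς k) (P.γ₃ * Q.ς k)

/-! ### Regularity assumptions on a run -/

/-- `f` is `C²`, and at each iteration the pullback is bounded above by its second-order Taylor
expansion up to a cubic term, with constant `L`. -/
def ScalarTaylorBound (L : ℝ) : Prop :=
  ContMDiff I 𝓘(ℝ, ℝ) 2 f ∧ ∀ k, Q.Reached k →
    pullback f R (Q.x k) (Q.s k) - taylorTwo (pullback f R (Q.x k)) (Q.s k)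
      ≤ L / 6 * ‖Q.s k‖ ^ 3

/-- Lipschitz-type condition along transports at successful iterations, with constant `L'`. Here
`w = P_{s_k}⁻¹ grad f(R_{x_k}(s_k))`, with `P_{s_k}` the parallel
transport along `t ↦ R_{x_k}(t s_k)`; it is used with `R` the exponential map. -/
def TransportTaylorBound (L' : ℝ) : Prop :=
  ∀ k, Q.Successful P f R k → ∃ w : TangentSpace I (Q.x k),
    IsParallelTransport (fun t : ℝ => R ⟨Q.x k, t • Q.s k⟩)
      (⟨Q.x k, w⟩ : TangentBundle I M) ⟨R ⟨Q.x k, Q.s k⟩, grad I f (R ⟨Q.x k, Q.s k⟩)⟩ ∧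
    ‖w - grad I f (Q.x k) - Hess I f (Q.x k) (Q.s k)‖ ≤ L' / 2 * ‖Q.s k‖ ^ 2

/-- Lipschitz-type condition on the gradients of the pullbacks at successful iterations, with constant
`L'` and function `q`. -/
def PullbackGradTaylorBound (L' : ℝ) (q : ℝ≥0 → ℝ≥0) : Prop :=
  Continuous q ∧ q 0 = 0 ∧ ∀ k, Q.Successful P f R k →
    ‖gradient (pullback f R (Q.x k)) (Q.s k) - gradient (pullback f R (Q.x k)) 0
        - hessian (pullback f R (Q.x k)) 0 (Q.s k)‖
      ≤ L' / 2 * ‖Q.s k‖ ^ 2 + q ‖Q.s k‖₊ * ‖grad I f (R ⟨Q.x k, Q.s k⟩)‖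

/-- At successful iterations with `‖s_k‖ ≤ a`, the least singular value of `DR_{x_k}(s_k)` is at least
`b`, with constants `a ∈ (0, ∞]` and `b > 0`. -/
def RetractionDerivBound (a : ℝ≥0∞) (b : ℝ) : Prop :=
  0 < a ∧ 0 < b ∧ ∀ k, Q.Successful P f R k → ENNReal.ofReal ‖Q.s k‖ ≤ a →
    b ≤ sigmaMin (fiberDeriv R (Q.x k) (Q.s k)).toLinearMap

/-- Within `B` iterations the run produces a point which is no worse than the initial point and is
approximately second-order critical. -/
def ReachesWithin (εg εH B : ℝ) : Prop :=
  ∃ k : ℕ, Q.Reached k ∧ (k : ℝ) ≤ B ∧ f (Q.x k) ≤ f (Q.x 0) ∧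
    ‖grad I f (Q.x k)‖ ≤ εg ∧ -εH ≤ lambdaMin (Hess I f (Q.x k))

end ARCSeq

end Algorithm

/-! ## Constants of the complexity bound; `Δ` stands for `f(x₀) - f_low` -/

namespace ARCParams

variable (P : ARCParams)

def ςmax (L : ℝ) : ℝ := max P.ς₀ (L * P.γ₃ / (2 * (1 - P.η₂)))

/-- `K₁` for the exponential map. -/
def K₁Exp (Δ L L' ε : ℝ) : ℝ :=
  3 * Δ / (P.η₁ * P.ςmin) * (L' / 2 + P.θ + P.ςmax L) ^ (1.5 : ℝ) * (1 / ε ^ (1.5 : ℝ))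

/-- `K₁` for a general retraction; `qr` stands for `q(r)`. -/
def K₁Retr (Δ L L' b qr r ε : ℝ) : ℝ :=
  3 * Δ / (P.η₁ * P.ςmin) *
    max (((L' / 2 + P.θ + P.ςmax L) / (b - qr)) ^ (1.5 : ℝ) * (1 / ε ^ (1.5 : ℝ))) (1 / r ^ 3)

def K₂ (Δ L ε : ℝ) : ℝ :=
  3 * Δ / (P.η₁ * P.ςmin) * (P.θ + 2 * P.ςmax L) ^ 3 * (1 / ε ^ 3)

/-- The bound on the number of iterations, given the values `K₁`, `K₂`. -/
def iterBound (L K₁ K₂ : ℝ) : ℝ :=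
  (1 + |Real.log P.γ₁| / Real.log P.γ₂) * (K₁ + K₂ + 1)
    + 1 / Real.log P.γ₂ * Real.log (P.ςmax L / P.ς₀) + 1

end ARCParams

end

open Bundle

/-!
Assume that none of the points `x_k` with `k` below the bound is approximately critical. Progress of
the model in the sense of the algorithm then makes every step nonzero: at a zero step the model, whose
derivatives at `0` up to order two are those of the pullback, has vanishing gradient and no negative
curvature.

The Euclidean model is related to the geometry of the manifold as follows. The gradient of the
pullback at `0` is `grad f(x)`, as `DR_x(0) = id` (`IsRetraction.gradient_pullback_zero`). Its Hessian
at `0` is `Hess f(x)` if the retraction is second order (`IsRetraction.hessian_pullback_zero`): in a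
chart, `D²R_x(0) = -Γ`, so the second-order chain rule yields `D²f - Df(Γ)`, which is the covariant
derivative of the gradient (`covariant_hessian_eq`). For the exponential map, parallel transport
preserves norms (`IsParallelTransport.norm_eq`), so the gradient at the new point has the norm of its
transport, which is at most a multiple of `‖s_k‖²`. For a general retraction, the gradient at the new
point is compared with that of the pullback at `s_k` by the adjoint of `DR_x(s_k)`, whose least
singular value is bounded below.

Consequently a successful step is long if it leads to a point with a large gradient, or if it starts
at a point with negative curvature of the Hessian. The cost decreases by at least
`η₁ ς_min ‖s_k‖³ / 3` at each successful step, which limits the number of such steps by `K₁` and `K₂`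
(`ARCSeq.IsRun.countBelow_successful_le`). Every successful step but the last is of the first kind, or
is followed by a successful step of the second kind (`countBelow_le`), so there are at most
`K₁ + K₂ + 1` successful steps. Since the regularization parameter never exceeds `ς_max` and grows by
the factor `γ₂` at each unsuccessful step, unsuccessful steps are controlled by the successful ones
(`ARCSeq.IsRun.le_of_countBelow_successful`), and the total number of steps is below the bound.
-/

/-! ### Eigenvalues and singular values -/

section EuclideanLemmas

variable {V : Type*} [NormedAddCommGroup V] [InnerProductSpace ℝ V]

/-- A symmetric operator whose eigenvalues are all at least `c` has Rayleigh quotient at least `c`. -/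
lemma LinearMap.IsSymmetric.mul_norm_sq_le_inner [FiniteDimensional ℝ V] {A : V →ₗ[ℝ] V}
    (hA : A.IsSymmetric) {n : ℕ} (hn : Module.finrank ℝ V = n) {c : ℝ}
    (hc : ∀ i, c ≤ hA.eigenvalues hn i) (v : V) : c * ‖v‖ ^ 2 ≤ ⟪v, A v⟫_ℝ := by
  have h1 : ⟪v, A v⟫_ℝ = ∑ i, hA.eigenvalues hn i * ⟪hA.eigenvectorBasis hn i, v⟫_ℝ ^ 2 := by
    rw [← (hA.eigenvectorBasis hn).sum_inner_mul_inner v (A v)]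
    refine Finset.sum_congr rfl fun i _ => ?_
    rw [← hA (hA.eigenvectorBasis hn i) v, hA.apply_eigenvectorBasis, inner_smul_left,
      real_inner_comm v]
    simp
    ring
  have h2 : ‖v‖ ^ 2 = ∑ i, ⟪hA.eigenvectorBasis hn i, v⟫_ℝ ^ 2 := by
    rw [← (hA.eigenvectorBasis hn).sum_sq_norm_inner_right v]
    simp
  rw [h1, h2, Finset.mul_sum]
  exact Finset.sum_le_sum fun i _ => mul_le_mul_of_nonneg_right (hc i) (sq_nonneg _)

lemma lambdaMin_mul_norm_sq_le [FiniteDimensional ℝ V] {A : V →ₗ[ℝ] V} (hA : A.IsSymmetric)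
    (v : V) : lambdaMin A * ‖v‖ ^ 2 ≤ ⟪v, A v⟫_ℝ :=
  hA.mul_norm_sq_le_inner rfl
    (fun i => csInf_le (Module.End.finite_hasEigenvalue A).bddBelow
      (hA.hasEigenvalue_eigenvalues rfl i)) v

/-- The hypothesis `c ≤ 0` covers the case of an operator without eigenvalues, where `lambdaMin` is
the infimum of the empty set. -/
lemma le_lambdaMin {A : V →ₗ[ℝ] V} {c : ℝ} (hc : c ≤ 0)
    (h : ∀ v, c * ‖v‖ ^ 2 ≤ ⟪v, A v⟫_ℝ) : c ≤ lambdaMin A := by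
  refine Real.le_sInf (fun μ hμ => ?_) hc
  obtain ⟨v, hv⟩ := hμ.exists_hasEigenvector
  have h1 := h v
  rw [hv.apply_eq_smul, inner_smul_right, real_inner_self_eq_norm_sq] at h1
  have : 0 < ‖v‖ := norm_pos_iff.2 hv.2
  exact le_of_mul_le_mul_right h1 (by positivity)

lemma sigmaMin_mul_norm_le {W : Type*} [NormedAddCommGroup W] [InnerProductSpace ℝ W]
    [FiniteDimensional ℝ V] [FiniteDimensional ℝ W] (A : V →ₗ[ℝ] W) (v : V) :
    sigmaMin A * ‖v‖ ≤ ‖A v‖ := by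
  have hsym := A.isSymmetric_adjoint_comp_self
  have h1 : sigmaMin A ^ 2 * ‖v‖ ^ 2 ≤ ⟪v, (LinearMap.adjoint A ∘ₗ A) v⟫_ℝ := by
    refine hsym.mul_norm_sq_le_inner rfl (fun i => ?_) v
    rw [← A.sq_singularValues_fin rfl i]
    exact pow_le_pow_left₀ (A.singularValues_nonneg _)
      (A.singularValues_antitone (Nat.le_sub_one_of_lt i.2)) 2
  rw [LinearMap.comp_apply, LinearMap.adjoint_inner_right, real_inner_self_eq_norm_sq,
    ← mul_pow] at h1
  exact le_of_sq_le_sq h1 (norm_nonneg _)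

/-- The adjoint `w ↦ g` of a map between spaces of the same dimension is bounded below by the least
singular value of the map. -/
lemma mul_norm_le_of_inner_eq {W : Type*} [NormedAddCommGroup W] [InnerProductSpace ℝ W]
    [FiniteDimensional ℝ V] [FiniteDimensional ℝ W] {A : V →ₗ[ℝ] W}
    (hVW : Module.finrank ℝ V = Module.finrank ℝ W) {b : ℝ} (hb : 0 < b) (hA : b ≤ sigmaMin A)
    {w : W} {g : V} (h : ∀ v, ⟪g, v⟫_ℝ = ⟪w, A v⟫_ℝ) : b * ‖w‖ ≤ ‖g‖ := by
  have hbound (v : V) : b * ‖v‖ ≤ ‖A v‖ :=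
    (mul_le_mul_of_nonneg_right hA (norm_nonneg v)).trans (sigmaMin_mul_norm_le A v)
  have hinj : Function.Injective A := by
    rw [injective_iff_map_eq_zero]
    intro v hv
    have h1 := hbound v
    rw [hv, norm_zero] at h1
    exact norm_le_zero_iff.1 (nonpos_of_mul_nonpos_right h1 hb)
  obtain ⟨v, rfl⟩ := (LinearMap.injective_iff_surjective_of_finrank_eq_finrank hVW).1 hinj w
  have h1 := h v
  rw [real_inner_self_eq_norm_sq] at h1
  have h2 := real_inner_le_norm g v
  have h3 := mul_le_mul_of_nonneg_left (hbound v) (norm_nonneg g)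
  rcases (norm_nonneg (A v)).eq_or_lt with h0 | h0
  · rw [← h0, mul_zero]
    exact norm_nonneg g
  · refine le_of_mul_le_mul_right (a := ‖A v‖) ?_ h0
    nlinarith

/-! ### The cubically regularized model -/

/-- The derivative of `s ↦ ‖s‖ s`. At `s = 0` the formula reads `0`, since `0⁻¹ = 0`. -/
lemma hasFDerivAt_norm_smul_self (s : V) :
    HasFDerivAt (fun s : V => ‖s‖ • s)
      (‖s‖ • ContinuousLinearMap.id ℝ V + (‖s‖⁻¹ • innerSL ℝ s).smulRight s) s := by
  rcases eq_or_ne s 0 with rfl | hs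
  · have h0 : ‖(0 : V)‖ • ContinuousLinearMap.id ℝ V
        + (‖(0 : V)‖⁻¹ • innerSL ℝ (0 : V)).smulRight (0 : V) = 0 := by
      ext v; simp
    rw [h0, hasFDerivAt_iff_isLittleO_nhds_zero]
    have h1 := (Asymptotics.isLittleO_norm_pow_id (E' := V) (n := 2) one_lt_two).norm_left
    refine Asymptotics.IsLittleO.of_norm_left (h1.congr_left fun x => ?_)
    simp [norm_smul, sq]
  · have hsq := ((hasStrictFDerivAt_norm_sq s).hasFDerivAt).sqrt (by positivity)
    have hn : HasFDerivAt (fun x : V => ‖x‖) (‖s‖⁻¹ • innerSL ℝ s) s := by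
      refine (hsq.congr_fderiv ?_).congr_of_eventuallyEq
        (Filter.Eventually.of_forall fun x => (Real.sqrt_sq (norm_nonneg x)).symm)
      ext v
      have : ‖s‖ ≠ 0 := norm_ne_zero_iff.2 hs
      simp [Real.sqrt_sq (norm_nonneg s)]
      field_simp
    exact hn.smul (hasFDerivAt_id s)

variable [CompleteSpace V]

lemma ContDiffAt.hasFDerivAt_gradient {g : V → ℝ} {x : V} (hg : ContDiffAt ℝ 2 g x) :
    HasFDerivAt (gradient g) (hessian g x) x := by
  have h : DifferentiableAt ℝ (fderiv ℝ g) x :=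
    (hg.fderiv_right (m := 1) (by norm_num)).differentiableAt (by norm_num)
  exact (((InnerProductSpace.toDual ℝ V).symm.toContinuousLinearEquiv.toContinuousLinearMap
    ).differentiableAt.comp x h).hasFDerivAt

lemma inner_hessian_apply {g : V → ℝ} {x : V} (hg : ContDiffAt ℝ 2 g x) (u v : V) :
    ⟪hessian g x u, v⟫_ℝ = fderiv ℝ (fderiv ℝ g) x u v := by
  have h2 : HasFDerivAt (fderiv ℝ g)
      (((InnerProductSpace.toDual ℝ V).toContinuousLinearEquiv.toContinuousLinearMap) ∘L
        hessian g x) x := by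
    refine (((InnerProductSpace.toDual ℝ V).toContinuousLinearEquiv.toContinuousLinearMap
      ).hasFDerivAt.comp x hg.hasFDerivAt_gradient).congr_of_eventuallyEq
      (Filter.Eventually.of_forall fun y => ?_)
    simp [gradient]
  rw [h2.fderiv]
  simp

lemma isSymmetric_hessian {g : V → ℝ} {x : V} (hg : ContDiffAt ℝ 2 g x) :
    (hessian g x).toLinearMap.IsSymmetric := by
  intro u v
  have h := hg.isSymmSndFDerivAt (by simp) u v
  simp only [ContinuousLinearMap.coe_coe]
  rw [inner_hessian_apply hg, h, ← inner_hessian_apply hg, real_inner_comm]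

lemma gradient_cubicModel {g : V → ℝ} (hg : ContDiffAt ℝ 2 g 0) (ς : ℝ) :
    gradient (cubicModel g ς) = fun s => gradient g 0 + hessian g 0 s + ς • (‖s‖ • s) := by
  refine gradient_eq fun s => ?_
  rw [hasGradientAt_iff_hasFDerivAt]
  have hlin : HasFDerivAt (fun s : V => ⟪s, gradient g 0⟫_ℝ) (innerSL ℝ (gradient g 0)) s :=
    (innerSL ℝ (gradient g 0)).hasFDerivAt.congr_of_eventuallyEq
      (Filter.Eventually.of_forall fun x => by simp)
  have hquad := (hasFDerivAt_id s).inner ℝ (hessian g 0).hasFDerivAt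
  have hcub : HasFDerivAt (fun x : V => ‖x‖ ^ 3) ((3 * ‖s‖) • innerSL ℝ s) s := by
    have h := hasFDerivAt_norm_rpow s (p := 3) (by norm_num)
    norm_num at h
    exact_mod_cast h
  refine ((((hasFDerivAt_const (g 0) s).add hlin).add (hquad.const_mul (1 / 2))).add
    (hcub.const_mul (ς / 3))).congr_fderiv ?_
  ext v
  have hs := isSymmetric_hessian hg s v
  simp only [ContinuousLinearMap.coe_coe] at hs
  simp [real_inner_comm (hessian g 0 s) v, hs, real_inner_comm v s]
  ring

lemma inner_hessian_cubicModel {g : V → ℝ} (hg : ContDiffAt ℝ 2 g 0) (ς : ℝ) (s u v : V) :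
    ⟪hessian (cubicModel g ς) s u, v⟫_ℝ =
      ⟪hessian g 0 u, v⟫_ℝ + ς * (‖s‖ * ⟪u, v⟫_ℝ + ‖s‖⁻¹ * ⟪s, u⟫_ℝ * ⟪s, v⟫_ℝ) := by
  have h := (((hasFDerivAt_const (gradient g 0) s).add (hessian g 0).hasFDerivAt).add
    ((hasFDerivAt_norm_smul_self s).const_smul ς)).fderiv
  rw [hessian, gradient_cubicModel hg]
  refine (congrArg (fun A : V →L[ℝ] V => ⟪A u, v⟫_ℝ) h).trans ?_
  simp [inner_add_left, inner_smul_left]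
  ring

lemma isSymmetric_hessian_cubicModel {g : V → ℝ} (hg : ContDiffAt ℝ 2 g 0) (ς : ℝ) (s : V) :
    (hessian (cubicModel g ς) s).toLinearMap.IsSymmetric := by
  intro u v
  have hs := isSymmetric_hessian hg u v
  simp only [ContinuousLinearMap.coe_coe] at hs ⊢
  rw [real_inner_comm _ u, inner_hessian_cubicModel hg, inner_hessian_cubicModel hg, hs,
    real_inner_comm u v, real_inner_comm _ u]
  ring

@[simp] lemma cubicModel_zero (g : V → ℝ) (ς : ℝ) : cubicModel g ς 0 = g 0 := by
  simp [cubicModel, taylorTwo]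

lemma norm_gradient_add_hessian_le {g : V → ℝ} (hg : ContDiffAt ℝ 2 g 0) {ς : ℝ} (hς : 0 ≤ ς)
    (s : V) :
    ‖gradient g 0 + hessian g 0 s‖ ≤ ‖gradient (cubicModel g ς) s‖ + ς * ‖s‖ ^ 2 := by
  have h : gradient g 0 + hessian g 0 s = gradient (cubicModel g ς) s - ς • (‖s‖ • s) := by
    rw [gradient_cubicModel hg]; simp
  rw [h]
  refine (norm_sub_le _ _).trans_eq ?_
  rw [norm_smul, norm_smul, norm_norm, Real.norm_of_nonneg hς]
  ring

/-- The regularization term adds at most `2ς‖s‖` to the curvature of the model, so that second-order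
progress of the model at `s` controls the negative curvature of `g` at `0`. -/
lemma neg_mul_norm_le_lambdaMin_hessian [FiniteDimensional ℝ V] {g : V → ℝ}
    (hg : ContDiffAt ℝ 2 g 0) {ς θ : ℝ} (hς : 0 ≤ ς) (hθ : 0 ≤ θ) {s : V}
    (h : -θ * ‖s‖ ≤ lambdaMin (hessian (cubicModel g ς) s).toLinearMap) :
    -((θ + 2 * ς) * ‖s‖) ≤ lambdaMin (hessian g 0).toLinearMap := by
  refine le_lambdaMin (neg_nonpos.2 (by positivity)) fun v => ?_
  have h1 := lambdaMin_mul_norm_sq_le (isSymmetric_hessian_cubicModel hg ς s) v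
  have h2 := (mul_le_mul_of_nonneg_right h (sq_nonneg ‖v‖)).trans h1
  simp only [ContinuousLinearMap.coe_coe] at h2 ⊢
  rw [real_inner_comm, inner_hessian_cubicModel hg, real_inner_self_eq_norm_sq] at h2
  have h3 : ‖s‖⁻¹ * ⟪s, v⟫_ℝ * ⟪s, v⟫_ℝ ≤ ‖s‖ * ‖v‖ ^ 2 := by
    have hcs : ⟪s, v⟫_ℝ ^ 2 ≤ (‖s‖ * ‖v‖) ^ 2 :=
      sq_le_sq.2 (by simpa [abs_mul] using abs_real_inner_le_norm s v)
    rcases eq_or_ne s 0 with rfl | hs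
    · simp
    · have : 0 < ‖s‖ := norm_pos_iff.2 hs
      rw [mul_assoc, ← sq, inv_mul_le_iff₀ this]
      linarith
  rw [real_inner_comm]
  nlinarith [mul_le_mul_of_nonneg_left h3 hς]

end EuclideanLemmas

/-! ### Second derivatives and Christoffel symbols in coordinates -/

section Coordinates

variable {E : Type*} [NormedAddCommGroup E] [NormedSpace ℝ E]

lemma fderiv_fderiv_comp_apply {V : Type*} [NormedAddCommGroup V] [NormedSpace ℝ V]
    {F : E → ℝ} {ρ : V → E} {x : V} (hF : ContDiffAt ℝ 2 F (ρ x)) (hρ : ContDiffAt ℝ 2 ρ x)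
    (u v : V) :
    fderiv ℝ (fderiv ℝ (fun y => F (ρ y))) x u v =
      fderiv ℝ (fderiv ℝ F) (ρ x) (fderiv ℝ ρ x u) (fderiv ℝ ρ x v)
        + fderiv ℝ F (ρ x) (fderiv ℝ (fderiv ℝ ρ) x u v) := by
  have hF' : DifferentiableAt ℝ (fderiv ℝ F) (ρ x) :=
    (hF.fderiv_right (m := 1) (by norm_num)).differentiableAt (by norm_num)
  have hρ' : DifferentiableAt ℝ (fderiv ℝ ρ) x :=
    (hρ.fderiv_right (m := 1) (by norm_num)).differentiableAt (by norm_num)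
  have hev : fderiv ℝ (fun y => F (ρ y)) =ᶠ[𝓝 x] fun y => (fderiv ℝ F (ρ y)) ∘L (fderiv ℝ ρ y) := by
    filter_upwards [hρ.eventually (by simp), hρ.continuousAt.eventually (hF.eventually (by simp))]
      with y h1 h2
    exact fderiv_comp y (h2.differentiableAt (by norm_num)) (h1.differentiableAt (by norm_num))
  have hρ1 : HasFDerivAt ρ (fderiv ℝ ρ x) x := (hρ.differentiableAt (by norm_num)).hasFDerivAt
  have h := (hF'.hasFDerivAt.comp x hρ1).clm_comp hρ'.hasFDerivAt
  rw [hev.fderiv_eq, HasFDerivAt.fderiv (f := fun y => (fderiv ℝ F (ρ y)) ∘L (fderiv ℝ ρ y)) h]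
  simp [add_comm]

lemma ContDiffAt.hasDerivAt_comp_smul {V : Type*} [NormedAddCommGroup V] [NormedSpace ℝ V]
    {ρ : V → E} (hρ : ContDiffAt ℝ 2 ρ 0) (s : V) :
    HasDerivAt (fun τ : ℝ => ρ (τ • s)) (fderiv ℝ ρ 0 s) 0 := by
  have hline : HasDerivAt (fun τ : ℝ => τ • s) s 0 := by
    simpa using (hasDerivAt_id (0 : ℝ)).smul_const s
  have h : HasFDerivAt ρ (fderiv ℝ ρ 0) ((0 : ℝ) • s) := by
    rw [zero_smul]; exact (hρ.differentiableAt (by norm_num)).hasFDerivAt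
  exact h.comp_hasDerivAt (0 : ℝ) hline

lemma ContDiffAt.hasDerivAt_fderiv_comp_smul {V : Type*} [NormedAddCommGroup V] [NormedSpace ℝ V]
    {ρ : V → E} (hρ : ContDiffAt ℝ 2 ρ 0) (s : V) :
    HasDerivAt (fun τ : ℝ => fderiv ℝ ρ (τ • s) s) (fderiv ℝ (fderiv ℝ ρ) 0 s s) 0 := by
  have hline : HasDerivAt (fun τ : ℝ => τ • s) s 0 := by
    simpa using (hasDerivAt_id (0 : ℝ)).smul_const s
  have h : HasFDerivAt (fderiv ℝ ρ) (fderiv ℝ (fderiv ℝ ρ) 0) ((0 : ℝ) • s) := by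
    rw [zero_smul]
    exact ((hρ.fderiv_right (m := 1) (by norm_num)).differentiableAt (by norm_num)).hasFDerivAt
  have h1 : HasDerivAt (fun τ : ℝ => fderiv ℝ ρ (τ • s)) (fderiv ℝ (fderiv ℝ ρ) 0 s) 0 :=
    HasFDerivAt.comp_hasDerivAt (E := V →L[ℝ] E) (0 : ℝ) h hline
  simpa only [map_zero, add_zero] using h1.clm_apply (hasDerivAt_const (0 : ℝ) s)

/-- If a metric is symmetric near a point, so are its derivatives there. -/
lemma fderiv_metric_comm {g : E → E →L[ℝ] E →L[ℝ] ℝ} {y : E} (hg : DifferentiableAt ℝ g y)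
    (hsym : ∀ᶠ z in 𝓝 y, ∀ u v, g z u v = g z v u) (u v w : E) :
    fderiv ℝ g y u v w = fderiv ℝ g y u w v := by
  have h (v w : E) : HasFDerivAt (fun z => g z v w) (((fderiv ℝ g y).flip v).flip w) y := by
    have := (hg.hasFDerivAt.clm_apply (hasFDerivAt_const v y)).clm_apply (hasFDerivAt_const w y)
    refine this.congr_fderiv ?_
    ext; simp
  have h1 := (h v w).unique ((h w v).congr_of_eventuallyEq (hsym.mono fun z hz => hz v w))
  simpa using congrArg (fun A : E →L[ℝ] ℝ => A u) h1

lemma christoffelFirst_comm {g : E → E →L[ℝ] E →L[ℝ] ℝ} {y : E} (hg : DifferentiableAt ℝ g y)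
    (hsym : ∀ᶠ z in 𝓝 y, ∀ u v, g z u v = g z v u) (u v : E) :
    christoffelFirst g y u v = christoffelFirst g y v u := by
  ext w
  simp [christoffelFirst, fderiv_metric_comm hg hsym w u v]
  ring

/-- A field `z` along a curve `γ` with `z' = -Γ(γ', z)` at a time has stationary length there. -/
lemma hasDerivWithinAt_metric_of_parallel {g : E → E →L[ℝ] E →L[ℝ] ℝ} {γ z : ℝ → E} {S : Set ℝ}
    {t : ℝ} {c' z' : E} (hg : DifferentiableAt ℝ g (γ t))
    (hsym : ∀ᶠ y in 𝓝 (γ t), ∀ u v, g y u v = g y v u)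
    (hγ : HasDerivWithinAt γ c' S t) (hz : HasDerivWithinAt z z' S t)
    (hpar : ∀ w, g (γ t) z' w + christoffelFirst g (γ t) c' (z t) w = 0) :
    HasDerivWithinAt (fun τ => g (γ τ) (z τ) (z τ)) 0 S t := by
  have h1 : HasDerivWithinAt (fun τ => g (γ τ)) (fderiv ℝ g (γ t) c') S t :=
    HasFDerivAt.comp_hasDerivWithinAt (E := E →L[ℝ] E →L[ℝ] ℝ) t hg.hasFDerivAt hγ
  have h2 := (h1.clm_apply hz).clm_apply hz
  refine h2.congr_deriv ?_
  have h3 := hpar (z t)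
  have h4 := hsym.self_of_nhds z' (z t)
  simp [christoffelFirst] at h3 ⊢
  linarith

variable [FiniteDimensional ℝ E]

/-- The covariant Hessian in coordinates. If `X` is the gradient of `F` for the metric `g`, then
`⟪∂_u X + Γ(u, X), v⟫ = D²F(u, v) - ⟪Γ(u, v), X⟫`. -/
lemma covariant_hessian_eq {g : E → E →L[ℝ] E →L[ℝ] ℝ} {F : E → ℝ} {X : E → E} {y : E}
    (hg : DifferentiableAt ℝ g y) (hsym : ∀ᶠ z in 𝓝 y, ∀ u v, g z u v = g z v u)
    (hnd : ∀ᶠ z in 𝓝 y, ∀ u, (∀ v, g z u v = 0) → u = 0)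
    (hF : ContDiffAt ℝ 2 F y) (hX : ∀ᶠ z in 𝓝 y, ∀ w, g z (X z) w = fderiv ℝ F z w) (u v : E) :
    g y (fderiv ℝ X y u) v + christoffelFirst g y u (X y) v =
      fderiv ℝ (fderiv ℝ F) y u v - christoffelFirst g y u v (X y) := by
  have hF' : DifferentiableAt ℝ (fderiv ℝ F) y :=
    (hF.fderiv_right (m := 1) (by norm_num)).differentiableAt (by norm_num)
  -- a nondegenerate form on a finite-dimensional space is invertible, so `X = g⁻¹ DF` is
  -- differentiable
  have hequiv : ∀ᶠ z in 𝓝 y, ∃ e : E ≃L[ℝ] (E →L[ℝ] ℝ), (e : E →L[ℝ] (E →L[ℝ] ℝ)) = g z := by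
    filter_upwards [hnd] with z hz
    have hinj : Function.Injective (g z) := by
      rw [injective_iff_map_eq_zero]
      exact fun u hu => hz u fun v => by simp [hu]
    have hdim : Module.finrank ℝ E = Module.finrank ℝ (E →L[ℝ] ℝ) := by
      rw [← (LinearMap.toContinuousLinearMap (𝕜 := ℝ) (E := E) (F' := ℝ)).finrank_eq,
        Module.finrank_linearMap]
      simp
    exact ⟨(LinearEquiv.ofInjectiveOfFinrankEq (g z).toLinearMap hinj hdim).toContinuousLinearEquiv,
      by ext; rfl⟩
  obtain ⟨e, he⟩ := hequiv.self_of_nhds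
  have hXinv : X =ᶠ[𝓝 y] fun z => (g z).inverse (fderiv ℝ F z) := by
    filter_upwards [hequiv, hX] with z ⟨e, he⟩ hz
    have : g z (X z) = fderiv ℝ F z := ContinuousLinearMap.ext hz
    rw [← this, ← he, ContinuousLinearMap.inverse_equiv]
    simp
  have hinv : DifferentiableAt ℝ (fun z => (g z).inverse) y := by
    have h := (contDiffAt_map_inverse (n := 1) (𝕜 := ℝ) e).differentiableAt (by norm_num)
    rw [he] at h
    exact h.comp y hg
  have hXd : DifferentiableAt ℝ X y := (hinv.clm_apply hF').congr_of_eventuallyEq hXinv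
  have h1 := ((hg.hasFDerivAt.clm_apply hXd.hasFDerivAt).clm_apply (hasFDerivAt_const v y)).unique
    ((hF'.hasFDerivAt.clm_apply (hasFDerivAt_const v y)).congr_of_eventuallyEq
      (hX.mono fun z hz => hz v))
  have h2 := congrArg (fun A : E →L[ℝ] ℝ => A u) h1
  simp at h2
  simp only [christoffelFirst, smul_apply, sub_apply, add_apply, ContinuousLinearMap.flip_apply, smul_eq_mul]
  rw [fderiv_metric_comm hg hsym u v (X y)]
  linarith

end Coordinates

/-! ### The metric and the gradient in a chart -/

section Chart

variable {E : Type*} [NormedAddCommGroup E] [NormedSpace ℝ E]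
  {H : Type*} [TopologicalSpace H] {I : ModelWithCorners ℝ E H}
  {M : Type*} [TopologicalSpace M] [ChartedSpace H M] [IsManifold I ∞ M]

lemma ofCoord_toCoord {p q : M} (hq : q ∈ (extChartAt I p).source) (v : TangentSpace I q) :
    ofCoord I p q (toCoord I p q v) = v := by
  rw [extChartAt_source] at hq
  exact (trivializationAt E (TangentSpace I : M → Type _) p).symmL_continuousLinearMapAt hq v

lemma toCoord_ofCoord {p q : M} (hq : q ∈ (extChartAt I p).source) (v : E) :
    toCoord I p q (ofCoord I p q v) = v := by
  rw [extChartAt_source] at hq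
  exact (trivializationAt E (TangentSpace I : M → Type _) p).continuousLinearMapAt_symmL hq v

lemma toCoord_eq_mfderiv {p q : M} (hq : q ∈ (extChartAt I p).source) (v : TangentSpace I q) :
    toCoord I p q v = mfderiv I 𝓘(ℝ, E) (extChartAt I p) q v := by
  rw [extChartAt_source] at hq
  exact congrArg (fun A => A v) (TangentBundle.continuousLinearMapAt_trivializationAt (𝕜 := ℝ) hq)

lemma contMDiffAt_ofCoord {p : M} [I.Boundaryless] {y : E} (hy : y ∈ (extChartAt I p).target)
    (u : E) :
    ContMDiffAt 𝓘(ℝ, E) I.tangent 1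
      (fun z => (⟨(extChartAt I p).symm z, ofCoord I p ((extChartAt I p).symm z) u⟩ :
        TangentBundle I M)) y := by
  set e := trivializationAt E (TangentSpace I : M → Type _) p with he
  have hmem : ∀ z ∈ (extChartAt I p).target, (extChartAt I p).symm z ∈ e.baseSet := fun z hz => by
    have := (extChartAt I p).map_target hz
    rwa [extChartAt_source] at this
  have h1 : ContMDiffOn 𝓘(ℝ, E) (I.prod 𝓘(ℝ, E)) 1
      (fun z => ((extChartAt I p).symm z, u)) (extChartAt I p).target :=
    (contMDiffOn_extChartAt_symm p).prodMk contMDiffOn_const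
  have h2 := (e.contMDiffOn_symm (IB := I) (n := 1)).comp h1
    (fun z hz => e.mem_target.2 (hmem z hz))
  refine (h2.congr fun z hz => ?_).contMDiffAt ((isOpen_extChartAt_target p).mem_nhds hy)
  have h3 := e.mk_symm (hmem z hz) u
  rw [Function.comp, ← h3]
  simp only [ofCoord, ← he]
  rw [e.symmL_apply (hmem z hz)]

lemma contDiffAt_comp_extChartAt_symm [I.Boundaryless] {f : M → ℝ} {n : ℕ∞}
    (hf : ContMDiff I 𝓘(ℝ, ℝ) n f) {p : M} {y : E}   (hy : y ∈ (extChartAt I p).target) :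
    ContDiffAt ℝ n (fun z => f ((extChartAt I p).symm z)) y := by
  have h := hf.contMDiffAt.comp y
    (((contMDiffOn_extChartAt_symm (I := I) (n := n) p) y hy).contMDiffAt
      ((isOpen_extChartAt_target p).mem_nhds hy))
  exact contMDiffAt_iff_contDiffAt.1 h

variable [RiemannianBundle (fun x : M => TangentSpace I x)]

lemma metricInChart_apply (p : M) (y u v : E) :
    metricInChart I p y u v = ⟪ofCoord I p ((extChartAt I p).symm y) u,
      ofCoord I p ((extChartAt I p).symm y) v⟫_ℝ := rfl

lemma metricInChart_comm (p : M) (y u v : E) :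
    metricInChart I p y u v = metricInChart I p y v u := by
  rw [metricInChart_apply, metricInChart_apply, real_inner_comm]

lemma metricInChart_extChartAt {p q : M} (hq : q ∈ (extChartAt I p).source) (u v : E) :
    metricInChart I p (extChartAt I p q) u v = ⟪ofCoord I p q u, ofCoord I p q v⟫_ℝ := by
  rw [metricInChart_apply, (extChartAt I p).left_inv hq]

lemma inner_eq_metricInChart {p q : M} (hq : q ∈ (extChartAt I p).source)
    (u v : TangentSpace I q) :
    ⟪u, v⟫_ℝ = metricInChart I p (extChartAt I p q) (toCoord I p q u) (toCoord I p q v) := by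
  rw [metricInChart_extChartAt hq, ofCoord_toCoord hq, ofCoord_toCoord hq]

lemma metricInChart_nondegenerate {p : M} {y : E} (hy : y ∈ (extChartAt I p).target) {u : E}
    (hu : ∀ v, metricInChart I p y u v = 0) : u = 0 := by
  have h := hu u
  rw [metricInChart_apply, inner_self_eq_zero] at h
  have h1 := toCoord_ofCoord ((extChartAt I p).map_target hy) u
  rw [← h1, h, map_zero]

variable [FiniteDimensional ℝ E]

omit [IsManifold I ∞ M] in
lemma inner_grad (f : M → ℝ) (x : M) (v : TangentSpace I x) :
    ⟪grad I f x, v⟫_ℝ = mvfderiv I f x v := by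
  simp [grad]

lemma inner_christoffel (p : M) (u v w : TangentSpace I p) :
    ⟪christoffel I p u v, w⟫_ℝ = christoffelFirst (metricInChart I p) (extChartAt I p p)
      (toCoord I p p u) (toCoord I p p v) (toCoord I p p w) := by
  simp [christoffel]

variable [I.Boundaryless]

lemma differentiableAt_metricInChart
    [IsContMDiffRiemannianBundle I ∞ E (fun x : M => TangentSpace I x)] {p : M} {y : E}
    (hy : y ∈ (extChartAt I p).target) : DifferentiableAt ℝ (metricInChart I p) y := by
  have h : ContDiffOn ℝ 1 (metricInChart I p) (extChartAt I p).target := by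
    refine contDiffOn_clm_apply.2 fun u => contDiffOn_clm_apply.2 fun v z hz => ?_
    have h1 : ContMDiffAt 𝓘(ℝ, E) 𝓘(ℝ, ℝ) 1 (fun z => ⟪ofCoord I p ((extChartAt I p).symm z) u,
        ofCoord I p ((extChartAt I p).symm z) v⟫_ℝ) z :=
      ContMDiffAt.inner_bundle (contMDiffAt_ofCoord hz u) (contMDiffAt_ofCoord hz v)
    exact (contMDiffAt_iff_contDiffAt.1 h1).contDiffWithinAt
  exact ((h y hy).contDiffAt ((isOpen_extChartAt_target p).mem_nhds hy)).differentiableAt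
    (by norm_num)

lemma metricInChart_grad {f : M → ℝ} (hf : ContMDiff I 𝓘(ℝ, ℝ) 2 f) {p : M} {y : E}
    (hy : y ∈ (extChartAt I p).target) (w : E) :
    metricInChart I p y
        (toCoord I p ((extChartAt I p).symm y) (grad I f ((extChartAt I p).symm y))) w =
      fderiv ℝ (fun z => f ((extChartAt I p).symm z)) y w := by
  have hq := (extChartAt I p).map_target hy
  have hq' := hq
  rw [extChartAt_source] at hq'
  rw [metricInChart_apply, ofCoord_toCoord hq, inner_grad]
  have h1 : MDifferentiableAt 𝓘(ℝ, E) I (extChartAt I p).symm y :=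
    (((contMDiffOn_extChartAt_symm (I := I) (n := 1) p) y hy).contMDiffAt
      ((isOpen_extChartAt_target p).mem_nhds hy)).mdifferentiableAt (by norm_num)
  have h2 := mfderiv_comp y (hf.mdifferentiableAt (by norm_num)) h1
  have h3 := TangentBundle.symmL_trivializationAt (𝕜 := ℝ) (I := I) hq'
  rw [(extChartAt I p).right_inv hy, I.range_eq_univ, mfderivWithin_univ] at h3
  rw [← mfderiv_eq_fderiv]
  refine Eq.trans ?_ (congrArg (fun A => A w) h2).symm
  have h4 := congrArg (fun A => A w) h3
  exact congrArg (fun a : TangentSpace I ((extChartAt I p).symm y) =>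
    mfderiv I 𝓘(ℝ, ℝ) f ((extChartAt I p).symm y) a) h4

end Chart

/-! ### Parallel transport and retractions -/

section Retraction

variable {E : Type*} [NormedAddCommGroup E] [NormedSpace ℝ E] [FiniteDimensional ℝ E]
  {H : Type*} [TopologicalSpace H] {I : ModelWithCorners ℝ E H} [I.Boundaryless]
  {M : Type*} [TopologicalSpace M] [ChartedSpace H M] [IsManifold I ∞ M]
  [RiemannianBundle (fun x : M => TangentSpace I x)]
  [IsContMDiffRiemannianBundle I ∞ E (fun x : M => TangentSpace I x)]

omit [I.Boundaryless] [IsContMDiffRiemannianBundle I ∞ E (fun x : M => TangentSpace I x)] in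
/-- The equation `z' + Γ(c', z) = 0` of a parallel field, in components and paired with a vector. The
point `p = c t` is a separate variable, so that an equation `c t = p` need not be definitional. -/
lemma HasCovDerivWithinAt.exists_coord {c : ℝ → M} {Z : ∀ t : ℝ, TangentSpace I (c t)}
    {S : Set ℝ} {t : ℝ} (h : HasCovDerivWithinAt c Z S t 0) {p : M} (hp : c t = p) :
    ∃ c' z' : E, HasDerivWithinAt (fun τ => extChartAt I p (c τ)) c' S t ∧
      HasDerivWithinAt (fun τ => toCoord I p (c τ) (Z τ)) z' S t ∧
      ∀ w, metricInChart I p (extChartAt I p p) z' w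
        + christoffelFirst (metricInChart I p) (extChartAt I p p) c' (toCoord I p (c t) (Z t)) w
          = 0 := by
  subst hp
  obtain ⟨-, c', z', h1, h2, h3⟩ := h
  refine ⟨c', z', h1, h2, fun w => ?_⟩
  have hq : c t ∈ (extChartAt I (c t)).source := mem_extChartAt_source (c t)
  have h4 := congrArg (fun v => ⟪v, ofCoord I (c t) (c t) w⟫_ℝ) h3
  simp only [inner_zero_left, inner_add_left, inner_christoffel, toCoord_ofCoord hq,
    ← metricInChart_extChartAt hq] at h4
  exact h4.symm

/-- Parallel transport is isometric: the metric is parallel. -/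
lemma IsParallelTransport.norm_eq {c : ℝ → M} {v w : TangentBundle I M}
    (h : IsParallelTransport c v w) : ‖v.2‖ = ‖w.2‖ := by
  obtain ⟨Z, hZ, rfl, rfl⟩ := h
  have hd : ∀ t ∈ Set.Icc (0 : ℝ) 1,
      HasDerivWithinAt (fun τ => ‖Z τ‖ ^ 2) 0 (Set.Icc 0 1) t := by
    intro t ht
    obtain ⟨c', z', h1, h2, h3⟩ := (hZ t ht).exists_coord rfl
    have hsrc : ∀ᶠ τ in 𝓝[Set.Icc 0 1] t, c τ ∈ (extChartAt I (c t)).source :=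
      (hZ t ht).1 (extChartAt_source_mem_nhds (c t))
    have heq : ∀ τ, c τ ∈ (extChartAt I (c t)).source → ‖Z τ‖ ^ 2 =
        metricInChart I (c t) (extChartAt I (c t) (c τ)) (toCoord I (c t) (c τ) (Z τ))
          (toCoord I (c t) (c τ) (Z τ)) := fun τ hτ => by
      rw [← inner_eq_metricInChart hτ, real_inner_self_eq_norm_sq]
    exact (hasDerivWithinAt_metric_of_parallel (g := metricInChart I (c t))
      (differentiableAt_metricInChart (mem_extChartAt_target (c t)))
      (Filter.Eventually.of_forall fun y u v => metricInChart_comm _ y u v) h1 h2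
      h3).congr_of_eventuallyEq (hsrc.mono heq) (heq t (mem_extChartAt_source (c t)))
  have hconst := constant_of_derivWithin_zero (f := fun τ => ‖Z τ‖ ^ 2)
    (fun t ht => (hd t ht).differentiableWithinAt)
    (fun t ht => (hd t (Set.Ico_subset_Icc_self ht)).derivWithin
      (uniqueDiffOn_Icc one_pos t (Set.Ico_subset_Icc_self ht))) 1 (Set.right_mem_Icc.2 zero_le_one)
  exact (pow_left_inj₀ (norm_nonneg _) (norm_nonneg _) two_ne_zero).1 hconst.symm

omit [FiniteDimensional ℝ E] [I.Boundaryless]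
  [IsContMDiffRiemannianBundle I ∞ E (fun x : M => TangentSpace I x)] in
lemma contMDiff_tangentBundle_mk (p : M) : ContMDiff 𝓘(ℝ, TangentSpace I p) I.tangent ∞
    (fun v : TangentSpace I p => (⟨p, v⟩ : TangentBundle I M)) := by
  intro v
  rw [contMDiffAt_totalSpace]
  refine ⟨contMDiffAt_const, ?_⟩
  have h : ContMDiff 𝓘(ℝ, TangentSpace I p) 𝓘(ℝ, E) ∞ (toCoord I p p) :=
    (toCoord I p p).contDiff.contMDiff
  refine (h v).congr_of_eventuallyEq (Filter.Eventually.of_forall fun u => ?_)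
  exact (congrFun ((trivializationAt E (TangentSpace I : M → Type _) p).coe_linearMapAt_of_mem
    (R := ℝ) (mem_baseSet_trivializationAt E (TangentSpace I : M → Type _) p)) u).symm

variable {R : TangentBundle I M → M}

namespace IsRetraction

variable (hR : IsRetraction R)
include hR

omit [FiniteDimensional ℝ E] [I.Boundaryless]
  [IsContMDiffRiemannianBundle I ∞ E (fun x : M => TangentSpace I x)]

lemma contMDiff_fiber (p : M) : ContMDiff 𝓘(ℝ, TangentSpace I p) I ∞
    (fun v : TangentSpace I p => R ⟨p, v⟩) :=
  hR.smooth.comp (contMDiff_tangentBundle_mk p)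

lemma apply_zero (p : M) : R ⟨p, 0⟩ = p :=
  congrArg TotalSpace.proj (hR.base p 0)

lemma contDiff_pullback {f : M → ℝ} (hf : ContMDiff I 𝓘(ℝ, ℝ) 2 f) (p : M) :
    ContDiff ℝ 2 (pullback f R p) :=
  (hf.comp ((hR.contMDiff_fiber p).of_le (by norm_cast))).contDiff

lemma fderiv_pullback {f : M → ℝ} (hf : ContMDiff I 𝓘(ℝ, ℝ) 2 f) (p : M)
    (s v : TangentSpace I p) :
    fderiv ℝ (pullback f R p) s v = mvfderiv I f (R ⟨p, s⟩) (fiberDeriv R p s v) := by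
  have h := mfderiv_comp s (hf.mdifferentiableAt (x := R ⟨p, s⟩) (by norm_num))
    ((hR.contMDiff_fiber p).mdifferentiableAt (x := s) (by norm_num))
  rw [← mfderiv_eq_fderiv]
  exact congrArg (fun A => A v) h

lemma fderiv_extChartAt_comp {p : M} {s : TangentSpace I p}
    (hs : R ⟨p, s⟩ ∈ (extChartAt I p).source) (v : TangentSpace I p) :
    fderiv ℝ (fun u : TangentSpace I p => extChartAt I p (R ⟨p, u⟩)) s v =
      toCoord I p (R ⟨p, s⟩) (fiberDeriv R p s v) := by
  have h := mfderiv_comp s (mdifferentiableAt_extChartAt (I := I) (x := p) (y := R ⟨p, s⟩)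
    (by rwa [extChartAt_source] at hs))
    ((hR.contMDiff_fiber p).mdifferentiableAt (x := s) (by norm_num))
  rw [toCoord_eq_mfderiv hs, ← mfderiv_eq_fderiv]
  exact congrArg (fun A => A v) h

lemma fderiv_extChartAt_comp_zero (p : M) (v : TangentSpace I p) :
    fderiv ℝ (fun u : TangentSpace I p => extChartAt I p (R ⟨p, u⟩)) 0 v = toCoord I p p v := by
  rw [hR.fderiv_extChartAt_comp (by rw [hR.apply_zero]; exact mem_extChartAt_source p)]
  exact congrArg (fun z : TangentBundle I M => toCoord I p z.1 z.2) (hR.base p v)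

lemma contDiffAt_extChartAt_comp {p : M} {s : TangentSpace I p}
    (hs : R ⟨p, s⟩ ∈ (extChartAt I p).source) :
    ContDiffAt ℝ 2 (fun u : TangentSpace I p => extChartAt I p (R ⟨p, u⟩)) s := by
  rw [extChartAt_source] at hs
  exact ((contMDiffAt_extChartAt' (n := 2) hs).comp s
    (((hR.contMDiff_fiber p).of_le (by norm_cast)) s)).contDiffAt

lemma inner_gradient_pullback [FiniteDimensional ℝ E] {f : M → ℝ}
    (hf : ContMDiff I 𝓘(ℝ, ℝ) 2 f) (p : M) (s v : TangentSpace I p) :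
    ⟪gradient (pullback f R p) s, v⟫_ℝ = ⟪grad I f (R ⟨p, s⟩), fiberDeriv R p s v⟫_ℝ := by
  rw [inner_grad, inner_gradient_left, hR.fderiv_pullback hf]

/-- This uses `DR_p(0) = id`. As `R_p(0) = p` is not definitional, it is read off from the equality
in the tangent bundle. -/
lemma gradient_pullback_zero [FiniteDimensional ℝ E] {f : M → ℝ}
    (hf : ContMDiff I 𝓘(ℝ, ℝ) 2 f) (p : M) : gradient (pullback f R p) 0 = grad I f p := by
  refine ext_inner_right ℝ fun v => ?_
  rw [inner_gradient_left, hR.fderiv_pullback hf, inner_grad]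
  exact congrArg (fun z : TangentBundle I M => mvfderiv I f z.1 z.2) (hR.base p v)

end IsRetraction

omit [FiniteDimensional ℝ E] [I.Boundaryless]
  [IsContMDiffRiemannianBundle I ∞ E (fun x : M => TangentSpace I x)] in
/-- Along `t ↦ R_p(ts)`, the components of the velocity in a chart are the derivative of the
chart expression. -/
lemma IsRetraction.toCoord_velocity (hR : IsRetraction R) {p : M} (s : TangentSpace I p) {t : ℝ}
    (ht : R ⟨p, t • s⟩ ∈ (extChartAt I p).source) :
    toCoord I p (R ⟨p, t • s⟩) (velocity I (fun τ : ℝ => R ⟨p, τ • s⟩) t) =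
      fderiv ℝ (fun u : TangentSpace I p => extChartAt I p (R ⟨p, u⟩)) (t • s) s := by
  have hline : HasFDerivAt (fun τ : ℝ => τ • s) ((1 : ℝ →L[ℝ] ℝ).smulRight s) t :=
    (hasDerivAt_id t).smul_const s |>.hasFDerivAt.congr_fderiv (by ext; simp)
  have h := mfderiv_comp t ((hR.contMDiff_fiber p).mdifferentiableAt (x := t • s) (by norm_num))
    (hline.differentiableAt.mdifferentiableAt)
  rw [hR.fderiv_extChartAt_comp ht]
  refine congrArg _ ?_
  rw [mfderiv_eq_fderiv, hline.fderiv] at h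
  refine (congrArg (fun A => A ((NormedSpace.fromTangentSpace t).symm (1 : ℝ))) h).trans ?_
  refine congrArg (mfderiv 𝓘(ℝ, TangentSpace I p) I (fun v : TangentSpace I p => R ⟨p, v⟩)
    (t • s)) ?_
  exact one_smul ℝ s

/-- In a chart, the second derivative at `0` of a second-order retraction is `-Γ`; the diagonal case
is the equation of zero acceleration, and the general case follows by polarization. -/
lemma IsRetraction.metricInChart_fderiv_fderiv (hR : IsRetraction R) (hR₂ : IsSecondOrder R)
    (p : M) (u v : TangentSpace I p) (w : E) :
    metricInChart I p (extChartAt I p p)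
        (fderiv ℝ (fderiv ℝ (fun u : TangentSpace I p => extChartAt I p (R ⟨p, u⟩))) 0 u v) w =
      -christoffelFirst (metricInChart I p) (extChartAt I p p) (toCoord I p p u) (toCoord I p p v)
        w := by
  set ρ : TangentSpace I p → E := fun u => extChartAt I p (R ⟨p, u⟩) with hρ
  have hsrc0 : R ⟨p, 0⟩ ∈ (extChartAt I p).source := by
    rw [hR.apply_zero]; exact mem_extChartAt_source p
  have hρ2 : ContDiffAt ℝ 2 ρ 0 := hR.contDiffAt_extChartAt_comp hsrc0
  have hdiag (s : TangentSpace I p) :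
      metricInChart I p (extChartAt I p p) (fderiv ℝ (fderiv ℝ ρ) 0 s s) w +
      christoffelFirst (metricInChart I p) (extChartAt I p p) (toCoord I p p s) (toCoord I p p s)
        w = 0 := by
    have hc0 : R ⟨p, (0 : ℝ) • s⟩ = p := by rw [zero_smul, hR.apply_zero]
    obtain ⟨c', z', h1, h2, h3⟩ := (hR₂ p s).exists_coord hc0
    rw [hasDerivWithinAt_univ] at h1 h2
    have hsrc : ∀ᶠ τ : ℝ in 𝓝 0, R ⟨p, τ • s⟩ ∈ (extChartAt I p).source := by
      have hcont : ContinuousAt (fun τ : ℝ => R ⟨p, τ • s⟩) 0 :=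
        ((hR.contMDiff_fiber p).continuous.comp
          (continuous_id.smul continuous_const)).continuousAt
      refine hcont.eventually_mem ?_
      rw [hc0]
      exact extChartAt_source_mem_nhds p
    have hc' : c' = toCoord I p p s :=
      (h1.unique (hρ2.hasDerivAt_comp_smul s)).trans (hR.fderiv_extChartAt_comp_zero p s)
    have hvel0 := hR.toCoord_velocity s (t := 0) (by rw [hc0]; exact mem_extChartAt_source p)
    have hz : toCoord I p (R ⟨p, (0 : ℝ) • s⟩) (velocity I (fun τ : ℝ => R ⟨p, τ • s⟩) 0)
        = toCoord I p p s := by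
      rw [hvel0, zero_smul]
      exact hR.fderiv_extChartAt_comp_zero p s
    have hz' : z' = fderiv ℝ (fderiv ℝ ρ) 0 s s :=
      h2.unique ((hρ2.hasDerivAt_fderiv_comp_smul s).congr_of_eventuallyEq
        (hsrc.mono fun τ hτ => hR.toCoord_velocity s hτ))
    have h6 := h3 w
    rwa [hz, hc', hz'] at h6
  have hsymm := hρ2.isSymmSndFDerivAt (by simp) u v
  have hΓ := christoffelFirst_comm (g := metricInChart I p)
    (differentiableAt_metricInChart (mem_extChartAt_target p))
    (Filter.Eventually.of_forall fun y u v => metricInChart_comm p y u v)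
  have h := hdiag (u + v)
  have hu := hdiag u
  have hv := hdiag v
  simp only [map_add, add_apply, christoffelFirst_add, hsymm,
    hΓ _ (toCoord I p p u + toCoord I p p v)] at h
  rw [hΓ (toCoord I p p v) (toCoord I p p u)] at h
  rw [hsymm]
  linarith

/-- For a second-order retraction, the Hessian of the pullback at the origin is the Riemannian
Hessian. -/
lemma IsRetraction.hessian_pullback_zero (hR : IsRetraction R) (hR₂ : IsSecondOrder R)
    {f : M → ℝ} (hf : ContMDiff I 𝓘(ℝ, ℝ) 2 f) (p : M) :
    (hessian (pullback f R p) 0).toLinearMap = Hess I f p := by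
  ext u
  refine ext_inner_right ℝ fun v => ?_
  set y := extChartAt I p p with hy
  set g := metricInChart I p
  set F : E → ℝ := fun z => f ((extChartAt I p).symm z)
  set X : E → E := fun z =>
    toCoord I p ((extChartAt I p).symm z) (grad I f ((extChartAt I p).symm z)) with hXdef
  set ρ : TangentSpace I p → E := fun u => extChartAt I p (R ⟨p, u⟩) with hρ
  have hp := mem_extChartAt_source (I := I) p
  have hyt : ∀ᶠ z in 𝓝 y, z ∈ (extChartAt I p).target := extChartAt_target_mem_nhds p
  have hF : ContDiffAt ℝ 2 F y := contDiffAt_comp_extChartAt_symm hf (mem_extChartAt_target p)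
  have hsrc0 : R ⟨p, 0⟩ ∈ (extChartAt I p).source := by
    rw [hR.apply_zero]; exact hp
  have hρ2 : ContDiffAt ℝ 2 ρ 0 := hR.contDiffAt_extChartAt_comp hsrc0
  have hρ0 : ρ 0 = y := by simp only [hρ, hR.apply_zero, hy]
  have hX0 : X y = toCoord I p p (grad I f p) := by
    simp only [hXdef, hy]
    rw [extChartAt_to_inv]
  have hcov := covariant_hessian_eq (g := g) (F := F) (X := X)
    (differentiableAt_metricInChart (mem_extChartAt_target p))
    (Filter.Eventually.of_forall fun y u v => metricInChart_comm p y u v)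
    (hyt.mono fun z hz u hu => metricInChart_nondegenerate hz hu) hF
    (hyt.mono fun z hz w => metricInChart_grad hf hz w) (toCoord I p p u) (toCoord I p p v)
  -- the chart at `p` covers `R_p(u)` for small `u` only
  have hpull : pullback f R p =ᶠ[𝓝 0] fun u => F (ρ u) := by
    have hcont : ContinuousAt (fun u : TangentSpace I p => R ⟨p, u⟩) 0 :=
      (hR.contMDiff_fiber p).continuous.continuousAt
    filter_upwards [hcont ((isOpen_extChartAt_source p).mem_nhds hsrc0)] with u hu
    simp only [F, hρ, pullback]
    rw [(extChartAt I p).left_inv hu]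
  have hHess : ⟪Hess I f p u, v⟫_ℝ = g y (fderiv ℝ X y (toCoord I p p u)) (toCoord I p p v)
      + christoffelFirst g y (toCoord I p p u) (X y) (toCoord I p p v) := by
    change ⟪ofCoord I p p (fderiv ℝ X y (toCoord I p p u)) + christoffel I p u (grad I f p), v⟫_ℝ
      = _
    rw [inner_add_left, inner_christoffel, inner_eq_metricInChart hp, toCoord_ofCoord hp, hX0]
  have hDF (w : E) : fderiv ℝ F y w = g y w (X y) := by
    rw [← metricInChart_grad hf (mem_extChartAt_target p), metricInChart_comm]
  rw [hHess, hcov]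
  rw [ContinuousLinearMap.coe_coe, inner_hessian_apply (hR.contDiff_pullback hf p).contDiffAt,
    hpull.fderiv.fderiv_eq, fderiv_fderiv_comp_apply (by rw [hρ0]; exact hF) hρ2, hρ0,
    hR.fderiv_extChartAt_comp_zero, hR.fderiv_extChartAt_comp_zero, hDF,
    hR.metricInChart_fderiv_fderiv hR₂]
  ring

omit [I.Boundaryless]
  [IsContMDiffRiemannianBundle I ∞ E (fun x : M => TangentSpace I x)] in
/-- The equation of a geodesic at time `0`. -/
lemma IsExponential.isSecondOrder (h : IsExponential R) :
    IsSecondOrder R :=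
  fun x s => (h x s).2 0

end Retraction

/-! ### Counting iterations -/

section Counting

open Classical in
/-- The number of `j < k` with the property `p`, as a real number. -/
noncomputable def countBelow (p : ℕ → Prop) (k : ℕ) : ℝ := Nat.count p k

lemma countBelow_zero (p : ℕ → Prop) : countBelow p 0 = 0 := by simp [countBelow]

lemma countBelow_succ_of {p : ℕ → Prop} {k : ℕ} (h : p k) :
    countBelow p (k + 1) = countBelow p k + 1 := by
  simp [countBelow, Nat.count_succ, h]

lemma countBelow_succ_of_not {p : ℕ → Prop} {k : ℕ} (h : ¬p k) :
    countBelow p (k + 1) = countBelow p k := by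
  simp [countBelow, Nat.count_succ, h]

/-- If every state has property `T` or `U`, and `U` can be lost only in a step of type `S`, then each
step of type `S` leads to a state with `T`, or is followed by a step of type `S` starting at a state
with `U`; the latter is missing at most for the last step. -/
lemma countBelow_le {S T U : ℕ → Prop} {k : ℕ} (hTU : ∀ j ≤ k, T j ∨ U j)
    (hU : ∀ j < k, ¬S j → U j → U (j + 1)) :
    countBelow S k ≤ countBelow (fun j => S j ∧ T (j + 1)) k
      + countBelow (fun j => S j ∧ U j) k + 1 := by
  classical
  -- the sharper bound, with `1` only if the current state has `U`, is preserved by each step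
  suffices h : ∀ i ≤ k, countBelow S i ≤ countBelow (fun j => S j ∧ T (j + 1)) i
      + countBelow (fun j => S j ∧ U j) i + (if U i then 1 else 0) by
    refine (h k le_rfl).trans ?_
    split_ifs <;> linarith
  intro i
  induction i with
  | zero =>
    intro _
    simp only [countBelow_zero]
    split_ifs <;> norm_num
  | succ i ih =>
    intro hi
    have ih := ih (by omega)
    have h1 := hTU (i + 1) hi
    have h2 := hU i (by omega)
    simp only [countBelow, Nat.count_succ, Nat.cast_add] at ih ⊢
    by_cases hS : S i <;> by_cases hUi : U i <;> by_cases hT' : T (i + 1) <;>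
      by_cases hU' : U (i + 1) <;> simp_all <;> linarith

lemma countBelow_le_of_decrease {p : ℕ → Prop} {a : ℕ → ℝ} {k : ℕ}
    (h0 : ∀ j < k, a (j + 1) ≤ a j) (h1 : ∀ j < k, p j → 1 ≤ a j - a (j + 1)) :
    countBelow p k ≤ a 0 - a k := by
  induction k with
  | zero => simp [countBelow_zero]
  | succ k ih =>
    have ih := ih (fun j hj => h0 j (by omega)) (fun j hj => h1 j (by omega))
    by_cases h : p k
    · rw [countBelow_succ_of h]
      linarith [h1 k (by omega) h]
    · rw [countBelow_succ_of_not h]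
      linarith [h0 k (by omega)]

/-- The lower bound `√(ε / C)` on `t`, in the cubic form in which it enters the decrease of the cost. -/
lemma one_le_rpow_mul_pow_three {ε C t : ℝ} (hε : 0 < ε) (hC : 0 ≤ C) (ht : 0 ≤ t)
    (h : ε ≤ C * t ^ 2) : 1 ≤ C ^ (1.5 : ℝ) * (1 / ε ^ (1.5 : ℝ)) * t ^ 3 := by
  have h1 := Real.rpow_le_rpow hε.le h (z := 1.5) (by norm_num)
  have h2 : (t ^ 2) ^ (1.5 : ℝ) = t ^ 3 := by
    rw [← Real.rpow_natCast t 2, ← Real.rpow_mul ht, ← Real.rpow_natCast t 3]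
    norm_num
  rw [Real.mul_rpow hC (sq_nonneg t), h2] at h1
  have h3 : 0 < ε ^ (1.5 : ℝ) := Real.rpow_pos_of_pos hε _
  rw [mul_one_div, div_mul_eq_mul_div, le_div_iff₀ h3, one_mul]
  exact h1

end Counting

/-! ### Runs of the algorithm -/

namespace ARCParams

variable (P : ARCParams)

lemma ς₀_pos : 0 < P.ς₀ := P.ςmin_pos.trans_le P.ςmin_le

lemma γ₂_pos : 0 < P.γ₂ := one_pos.trans P.γ₂_gt

lemma ςmax_pos (L : ℝ) : 0 < P.ςmax L := P.ς₀_pos.trans_le (le_max_left _ _)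

end ARCParams

namespace ARCSeq

variable {E : Type*} [NormedAddCommGroup E] [NormedSpace ℝ E] [FiniteDimensional ℝ E]
  {H : Type*} [TopologicalSpace H] {I : ModelWithCorners ℝ E H}
  {M : Type*} [TopologicalSpace M] [ChartedSpace H M]
  [RiemannianBundle (fun x : M => TangentSpace I x)]
  {Q : ARCSeq I M} {P : ARCParams} {f : M → ℝ} {R : TangentBundle I M → M} {x₀ : M}

omit [FiniteDimensional ℝ E] [RiemannianBundle (fun x : M => TangentSpace I x)] in
lemma reached_zero : Q.Reached 0 := fun _ h => absurd h (Nat.not_lt_zero _)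

omit [FiniteDimensional ℝ E] [RiemannianBundle (fun x : M => TangentSpace I x)] in
lemma reached_succ {k : ℕ} : Q.Reached (k + 1) ↔ Q.Reached k ∧ Q.s k ≠ 0 := by
  refine ⟨fun h => ⟨fun j hj => h j (by omega), h k (by omega)⟩, fun h j hj => ?_⟩
  rcases Nat.lt_succ_iff_lt_or_eq.1 hj with hj | rfl
  exacts [h.1 j hj, h.2]

namespace IsRun

variable (hQ : Q.IsRun P f R x₀)
include hQ

lemma ςmin_le {k : ℕ} (hk : Q.Reached k) : P.ςmin ≤ Q.ς k := by
  induction k with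
  | zero => rw [hQ.ς_zero]; exact P.ςmin_le
  | succ k ih =>
    obtain ⟨hk, hs⟩ := reached_succ.1 hk
    have ih := ih hk
    rcases lt_or_ge (Q.rho f R k) P.η₁ with h | h
    · have h1 := (hQ.unsuccessful k hk hs h).1
      nlinarith [P.γ₂_gt, P.ςmin_pos]
    · rcases lt_or_ge (Q.rho f R k) P.η₂ with h' | h'
      · exact ih.trans (hQ.successful k hk hs ⟨h, h'⟩).1
      · exact (le_max_left _ _).trans (hQ.very_successful k hk hs h').1

lemma ς_pos {k : ℕ} (hk : Q.Reached k) : 0 < Q.ς k := P.ςmin_pos.trans_le (hQ.ςmin_le hk)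

lemma ς_mul_le_denominator {k : ℕ} (hk : Q.Reached k) :
    Q.ς k / 3 * ‖Q.s k‖ ^ 3 ≤
      Q.model f R k 0 - Q.model f R k (Q.s k) + Q.ς k / 3 * ‖Q.s k‖ ^ 3 := by
  linarith [hQ.decrease k hk]

lemma denominator_pos {k : ℕ} (hk : Q.Reached k) (hs : Q.s k ≠ 0) :
    0 < Q.model f R k 0 - Q.model f R k (Q.s k) + Q.ς k / 3 * ‖Q.s k‖ ^ 3 := by
  have h1 := hQ.ς_pos hk
  have h2 : 0 < ‖Q.s k‖ := norm_pos_iff.2 hs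
  exact lt_of_lt_of_le (by positivity) (hQ.ς_mul_le_denominator hk)

lemma decrease_of_successful {k : ℕ} (hk : Q.Successful P f R k) :
    P.η₁ * P.ςmin / 3 * ‖Q.s k‖ ^ 3 ≤ f (Q.x k) - f (Q.x (k + 1)) := by
  obtain ⟨hk, hs, hρ⟩ := hk
  rw [hQ.accept k hk hs hρ]
  rw [rho, le_div_iff₀ (hQ.denominator_pos hk hs)] at hρ
  refine le_trans ?_ hρ
  have h1 : P.ςmin / 3 * ‖Q.s k‖ ^ 3 ≤ Q.ς k / 3 * ‖Q.s k‖ ^ 3 := by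
    have := hQ.ςmin_le hk
    gcongr
  have h2 := mul_le_mul_of_nonneg_left (h1.trans (hQ.ς_mul_le_denominator hk)) P.η₁_pos.le
  linarith

lemma x_succ_of_not_successful {k : ℕ} (hk : Q.Reached (k + 1)) (h : ¬Q.Successful P f R k) :
    Q.x (k + 1) = Q.x k := by
  obtain ⟨hk, hs⟩ := reached_succ.1 hk
  refine hQ.reject k hk hs ?_
  by_contra! h'
  exact h ⟨hk, hs, h'⟩

lemma f_succ_le {k : ℕ} (hk : Q.Reached (k + 1)) :
    f (Q.x (k + 1)) ≤ f (Q.x k) := by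
  by_cases h : Q.Successful P f R k
  · have h1 := hQ.decrease_of_successful h
    have h2 : 0 ≤ P.η₁ * P.ςmin / 3 * ‖Q.s k‖ ^ 3 := by
      have := P.η₁_pos
      have := P.ςmin_pos
      positivity
    linarith
  · rw [hQ.x_succ_of_not_successful hk h]

lemma f_le_zero {k : ℕ} (hk : Q.Reached k) : f (Q.x k) ≤ f (Q.x 0) := by
  induction k with
  | zero => exact le_rfl
  | succ k ih => exact (hQ.f_succ_le hk).trans (ih (reached_succ.1 hk).1)

/-- Unsuccessful iterations multiply the regularization parameter by at least `γ₂`, successful ones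
by at least `γ₁`. -/
lemma log_ς_ge {k : ℕ} (hk : Q.Reached k) :
    Real.log P.ς₀ + countBelow (Q.Successful P f R) k * Real.log P.γ₁
      + (k - countBelow (Q.Successful P f R) k) * Real.log P.γ₂ ≤ Real.log (Q.ς k) := by
  induction k with
  | zero => simp [countBelow_zero, hQ.ς_zero]
  | succ k ih =>
    obtain ⟨hk', hs⟩ := reached_succ.1 hk
    have ih := ih hk'
    have hpos := hQ.ς_pos hk'
    push_cast
    by_cases h : Q.Successful P f R k
    · rw [countBelow_succ_of h]
      have h1 : P.γ₁ * Q.ς k ≤ Q.ς (k + 1) := by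
        rcases lt_or_ge (Q.rho f R k) P.η₂ with h' | h'
        · exact (mul_le_of_le_one_left hpos.le P.γ₁_lt.le).trans
            (hQ.successful k hk' hs ⟨h.2.2, h'⟩).1
        · exact (le_max_right _ _).trans (hQ.very_successful k hk' hs h').1
      have h2 := Real.log_le_log (mul_pos P.γ₁_pos hpos) h1
      rw [Real.log_mul P.γ₁_pos.ne' hpos.ne'] at h2
      linarith
    · rw [countBelow_succ_of_not h]
      have h1 : P.γ₂ * Q.ς k ≤ Q.ς (k + 1) := by
        refine (hQ.unsuccessful k hk' hs ?_).1
        by_contra! h'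
        exact h ⟨hk', hs, h'⟩
      have h2 := Real.log_le_log (mul_pos P.γ₂_pos hpos) h1
      rw [Real.log_mul P.γ₂_pos.ne' hpos.ne'] at h2
      linarith

/-- Each successful iteration of a type with steps bounded below, in the sense `1 ≤ κ‖s‖³`, takes a
fixed amount off the cost; hence there are few of them. -/
lemma countBelow_successful_le {flow : ℝ} (hlow : ∀ x, flow ≤ f x) {κ : ℝ}
    (hκ : 0 ≤ κ) {p : ℕ → Prop} {k : ℕ} (hk : Q.Reached k)
    (h : ∀ j, Q.Successful P f R j → p j → 1 ≤ κ * ‖Q.s j‖ ^ 3) :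
    countBelow (fun j => Q.Successful P f R j ∧ p j) k ≤
      3 * (f x₀ - flow) / (P.η₁ * P.ςmin) * κ := by
  have hη := P.η₁_pos
  have hς := P.ςmin_pos
  have hreach : ∀ j < k, Q.Reached (j + 1) := fun j hj i hi => hk i (by omega)
  have h1 := countBelow_le_of_decrease (p := fun j => Q.Successful P f R j ∧ p j)
    (a := fun j => 3 * κ / (P.η₁ * P.ςmin) * f (Q.x j)) (k := k)
    (fun j hj => mul_le_mul_of_nonneg_left (hQ.f_succ_le (hreach j hj)) (by positivity))
    (fun j _ hp => by
      have h2 := hQ.decrease_of_successful hp.1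
      rw [← mul_sub]
      refine (h j hp.1 hp.2).trans (le_trans (le_of_eq ?_)
        (mul_le_mul_of_nonneg_left h2 (by positivity)))
      field_simp)
  refine h1.trans ?_
  rw [← mul_sub, hQ.x_zero]
  have h3 : 3 * κ / (P.η₁ * P.ςmin) * (f x₀ - f (Q.x k)) ≤
      3 * κ / (P.η₁ * P.ςmin) * (f x₀ - flow) :=
    mul_le_mul_of_nonneg_left (by linarith [hlow (Q.x k)]) (by positivity)
  refine h3.trans_eq ?_
  ring

end IsRun

variable [IsManifold I ∞ M]

lemma model_zero (hR : IsRetraction R) (k : ℕ) : Q.model f R k 0 = f (Q.x k) := by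
  rw [model, cubicModel_zero, pullback, hR.apply_zero]

namespace IsRun

variable (hQ : Q.IsRun P f R x₀)
include hQ

/-- A large regularization parameter makes the model overestimate the cost, so that the iteration is
very successful. -/
lemma η₂_le_rho (hR : IsRetraction R) {L : ℝ} (hL : Q.ScalarTaylorBound f R L) {k : ℕ}
    (hk : Q.Reached k) (hs : Q.s k ≠ 0) (hς : L / (2 * (1 - P.η₂)) ≤ Q.ς k) :
    P.η₂ ≤ Q.rho f R k := by
  rw [rho, le_div_iff₀ (hQ.denominator_pos hk hs)]
  have h1 := hQ.ς_mul_le_denominator hk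
  have h2 := hL.2 k hk
  have h3 : 0 < 1 - P.η₂ := sub_pos.2 P.η₂_lt
  rw [div_le_iff₀ (by positivity)] at hς
  have h4 := mul_le_mul_of_nonneg_left h1 h3.le
  have h5 := mul_le_mul_of_nonneg_right hς (by positivity : 0 ≤ ‖Q.s k‖ ^ 3)
  have h6 : Q.model f R k 0 - Q.model f R k (Q.s k) + Q.ς k / 3 * ‖Q.s k‖ ^ 3 =
      f (Q.x k) - taylorTwo (pullback f R (Q.x k)) (Q.s k) := by
    rw [model_zero hR, model, cubicModel]
    ring
  rw [h6] at h4 ⊢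
  rw [pullback] at h2
  linarith

lemma ς_le_ςmax (hR : IsRetraction R) {L : ℝ} (hL : Q.ScalarTaylorBound f R L) {k : ℕ}
    (hk : Q.Reached k) : Q.ς k ≤ P.ςmax L := by
  induction k with
  | zero => rw [hQ.ς_zero]; exact le_max_left _ _
  | succ k ih =>
    obtain ⟨hk, hs⟩ := reached_succ.1 hk
    rcases lt_or_ge (Q.rho f R k) P.η₂ with h | h
    · have h1 : Q.ς k < L / (2 * (1 - P.η₂)) := by
        by_contra! h'
        exact absurd (hQ.η₂_le_rho hR hL hk hs h') (not_le.2 h)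
      have h2 : Q.ς (k + 1) ≤ P.γ₃ * Q.ς k := by
        rcases lt_or_ge (Q.rho f R k) P.η₁ with h' | h'
        · exact (hQ.unsuccessful k hk hs h').2
        · exact (hQ.successful k hk hs ⟨h', h⟩).2.trans
            (mul_le_mul_of_nonneg_right P.γ₂_lt.le (hQ.ς_pos hk).le)
      refine h2.trans ((mul_le_mul_of_nonneg_left h1.le
        (P.γ₂_pos.trans P.γ₂_lt).le).trans (le_trans (le_of_eq ?_) (le_max_right _ _)))
      ring
    · exact (hQ.very_successful k hk hs h).2.trans (ih hk)

lemma le_of_countBelow_successful (hR : IsRetraction R) {L : ℝ} (hL : Q.ScalarTaylorBound f R L)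
    {k : ℕ} (hk : Q.Reached k) :
    (k : ℝ) ≤ (1 + |Real.log P.γ₁| / Real.log P.γ₂) * countBelow (Q.Successful P f R) k
      + 1 / Real.log P.γ₂ * Real.log (P.ςmax L / P.ς₀) := by
  have h1 := hQ.log_ς_ge hk
  have h2 := Real.log_le_log (hQ.ς_pos hk) (hQ.ς_le_ςmax hR hL hk)
  have h3 : 0 < Real.log P.γ₂ := Real.log_pos P.γ₂_gt
  rw [abs_of_neg (Real.log_neg P.γ₁_pos P.γ₁_lt),
    Real.log_div (P.ςmax_pos L).ne' P.ς₀_pos.ne']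
  refine le_of_mul_le_mul_right (a := Real.log P.γ₂) ?_ h3
  field_simp
  linarith

end IsRun

end ARCSeq

/-! ### Complexity -/

namespace ARCSeq.IsRun

variable {E : Type*} [NormedAddCommGroup E] [NormedSpace ℝ E] [FiniteDimensional ℝ E]
  {H : Type*} [TopologicalSpace H] {I : ModelWithCorners ℝ E H}
  {M : Type*} [TopologicalSpace M] [ChartedSpace H M]
  [RiemannianBundle (fun x : M => TangentSpace I x)] [IsManifold I ∞ M]
  {Q : ARCSeq I M} {P : ARCParams} {f : M → ℝ} {R : TangentBundle I M → M} {x₀ : M}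

/-- First-order progress of the model makes the linearized gradient at the step small. -/
lemma norm_gradient_add_hessian_pullback_le (hQ : Q.IsRun P f R x₀) (hR : IsRetraction R) {L : ℝ}
    (hL : Q.ScalarTaylorBound f R L) {k : ℕ} (hk : Q.Reached k) :
    ‖gradient (pullback f R (Q.x k)) 0 + hessian (pullback f R (Q.x k)) 0 (Q.s k)‖ ≤
      (P.θ + P.ςmax L) * ‖Q.s k‖ ^ 2 := by
  have h1 := norm_gradient_add_hessian_le (hR.contDiff_pullback hL.1 (Q.x k)).contDiffAt
    (hQ.ς_pos hk).le (Q.s k)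
  have h2 := hQ.grad_le k hk
  have h3 := mul_le_mul_of_nonneg_right (hQ.ς_le_ςmax hR hL hk) (sq_nonneg ‖Q.s k‖)
  rw [model] at h2
  linarith

/-- Second-order progress of the model bounds the negative curvature of the cost by the step. -/
lemma neg_le_lambdaMin_Hess (hQ : Q.IsRun P f R x₀) (hR : IsRetraction R) {L : ℝ}
    (hL : Q.ScalarTaylorBound f R L)
    (hHess : ∀ x, (hessian (pullback f R x) 0).toLinearMap = Hess I f x)
    {k : ℕ} (hk : Q.Reached k) :
    -((P.θ + 2 * P.ςmax L) * ‖Q.s k‖) ≤ lambdaMin (Hess I f (Q.x k)) := by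
  have h1 := neg_mul_norm_le_lambdaMin_hessian (hR.contDiff_pullback hL.1 (Q.x k)).contDiffAt
    (hQ.ς_pos hk).le P.θ_pos.le (hQ.hess_ge k hk)
  rw [hHess] at h1
  have h3 := mul_le_mul_of_nonneg_right (hQ.ς_le_ςmax hR hL hk) (norm_nonneg (Q.s k))
  linarith

/-- The complexity bound, given that a successful step to a point with a large gradient is long. -/
lemma reachesWithin (hQ : Q.IsRun P f R x₀) (hR : IsRetraction R) {flow : ℝ}
    (hlow : ∀ x, flow ≤ f x) {L : ℝ} (hL : Q.ScalarTaylorBound f R L)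
    (hHess : ∀ x, (hessian (pullback f R x) 0).toLinearMap = Hess I f x)
    {εg εH : ℝ} (hεg : 0 < εg) (hεH : 0 < εH) {κ : ℝ} (hκ : 0 ≤ κ)
    (hgrad : ∀ k, Q.Successful P f R k → εg < ‖grad I f (R ⟨Q.x k, Q.s k⟩)‖ →
      1 ≤ κ * ‖Q.s k‖ ^ 3) :
    Q.ReachesWithin f εg εH (P.iterBound L (3 * (f x₀ - flow) / (P.η₁ * P.ςmin) * κ)
      (P.K₂ (f x₀ - flow) L εH)) := by
  set B := P.iterBound L (3 * (f x₀ - flow) / (P.η₁ * P.ςmin) * κ) (P.K₂ (f x₀ - flow) L εH)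
    with hB
  by_contra hno
  -- the cost never increases, so one of the two criticality conditions fails
  have hnc : ∀ k, Q.Reached k → (k : ℝ) ≤ B →
      εg < ‖grad I f (Q.x k)‖ ∨ lambdaMin (Hess I f (Q.x k)) < -εH := by
    intro k hk hkB
    by_contra! h
    exact hno ⟨k, hk, hkB, hQ.f_le_zero hk, h⟩
  -- a zero step would be taken at a second-order critical point
  have hstep : ∀ k, Q.Reached k → (k : ℝ) ≤ B → Q.s k ≠ 0 := by
    intro k hk hkB hs
    rcases hnc k hk hkB with h | h
    · have h1 := hQ.norm_gradient_add_hessian_pullback_le hR hL hk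
      rw [hs, map_zero, add_zero, hR.gradient_pullback_zero hL.1, norm_zero] at h1
      norm_num at h1
      rw [h1, norm_zero] at h
      exact absurd h hεg.le.not_gt
    · have h1 := hQ.neg_le_lambdaMin_Hess hR hL hHess hk
      rw [hs, norm_zero] at h1
      linarith
  have hΔ : 0 ≤ 3 * (f x₀ - flow) / (P.η₁ * P.ςmin) := by
    have := P.η₁_pos
    have := P.ςmin_pos
    have := hlow x₀
    exact div_nonneg (by linarith) (by positivity)
  have hlogγ : 0 < Real.log P.γ₂ := Real.log_pos P.γ₂_gt
  have hςm := P.ςmax_pos L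
  have hθ := P.θ_pos
  have hratio : 0 ≤ |Real.log P.γ₁| / Real.log P.γ₂ := by positivity
  have hlogς : 0 ≤ 1 / Real.log P.γ₂ * Real.log (P.ςmax L / P.ς₀) :=
    mul_nonneg (by positivity)
      (Real.log_nonneg ((one_le_div P.ς₀_pos).2 (le_max_left _ _)))
  have hK₂ : 0 ≤ P.K₂ (f x₀ - flow) L εH := by
    rw [ARCParams.K₂]
    positivity
  have hK₁ := mul_nonneg hΔ hκ
  have hB0 : 0 ≤ B := by
    rw [hB, ARCParams.iterBound]
    positivity
  -- all iterations up to `N = ⌊B⌋` take place; counting them yields `N + 1 ≤ B`, which is absurd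
  set N := ⌊B⌋₊ with hN
  have hNB : (N : ℝ) ≤ B := Nat.floor_le hB0
  have hreach : ∀ k ≤ N, Q.Reached k := by
    intro k
    induction k with
    | zero => exact fun _ => reached_zero
    | succ k ih =>
      intro hk
      refine reached_succ.2 ⟨ih (by omega), hstep k (ih (by omega)) (le_trans ?_ hNB)⟩
      exact_mod_cast (by omega : k ≤ N)
  have hcount := countBelow_le (S := Q.Successful P f R) (T := fun k => εg < ‖grad I f (Q.x k)‖)
    (U := fun k => lambdaMin (Hess I f (Q.x k)) < -εH) (k := N)
    (fun j hj => hnc j (hreach j hj) (le_trans (by exact_mod_cast hj) hNB))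
    (fun j hj hS hU => by
      have h : ∀ x, x = Q.x j → lambdaMin (Hess I f x) < -εH := by
        rintro _ rfl
        exact hU
      exact h _ (hQ.x_succ_of_not_successful (hreach (j + 1) hj) hS))
  have hG := hQ.countBelow_successful_le hlow hκ (p := fun j => εg < ‖grad I f (Q.x (j + 1))‖)
    (hreach N le_rfl) (fun j hj h => hgrad j hj (by rwa [← hQ.accept j hj.1 hj.2.1 hj.2.2]))
  have hH := hQ.countBelow_successful_le hlow
    (κ := (P.θ + 2 * P.ςmax L) ^ 3 * (1 / εH ^ 3)) (by positivity)
    (p := fun j => lambdaMin (Hess I f (Q.x j)) < -εH) (hreach N le_rfl) (fun j hj h => by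
      have h1 := hQ.neg_le_lambdaMin_Hess hR hL hHess hj.1
      have h2 : εH ^ 3 ≤ ((P.θ + 2 * P.ςmax L) * ‖Q.s j‖) ^ 3 :=
        pow_le_pow_left₀ hεH.le (by linarith) 3
      rw [mul_one_div, div_mul_eq_mul_div, le_div_iff₀ (by positivity), one_mul, ← mul_pow]
      exact h2)
  rw [← mul_assoc] at hH
  have hN1 := hQ.le_of_countBelow_successful hR hL (hreach N le_rfl)
  have hle : countBelow (Q.Successful P f R) N ≤
      3 * (f x₀ - flow) / (P.η₁ * P.ςmin) * κ + P.K₂ (f x₀ - flow) L εH + 1 := by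
    rw [ARCParams.K₂]
    linarith
  have h1 := mul_le_mul_of_nonneg_left hle (by linarith : 0 ≤ 1 + |Real.log P.γ₁| / Real.log P.γ₂)
  have h2 : B < N + 1 := Nat.lt_floor_add_one B
  rw [hB, ARCParams.iterBound] at h2
  linarith

/-- The step is either longer than `r`, or short enough for the differential of the retraction to be
well conditioned and for the term with `q` to be absorbed. -/
lemma one_le_of_pullbackGradTaylorBound (hQ : Q.IsRun P f R x₀) (hR : IsRetraction R) {L : ℝ}
    (hL : Q.ScalarTaylorBound f R L) {L' : ℝ} (hL' : 0 ≤ L') {q : ℝ≥0 → ℝ≥0} {a : ℝ≥0∞} {b : ℝ}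
    (hT : Q.PullbackGradTaylorBound P f R L' q) (hD : Q.RetractionDerivBound P f R a b)
    {r : ℝ≥0} (hr : 0 < r) (hra : (r : ℝ≥0∞) ≤ a) (hqr : (q r : ℝ) < b)
    (hq : ∀ t ≤ r, q t ≤ q r) {ε : ℝ} (hε : 0 < ε) {k : ℕ}
    (hk : Q.Successful P f R k) (hg : ε < ‖grad I f (R ⟨Q.x k, Q.s k⟩)‖) :
    1 ≤ max (((L' / 2 + P.θ + P.ςmax L) / (b - q r)) ^ (1.5 : ℝ) * (1 / ε ^ (1.5 : ℝ)))
      (1 / r ^ 3) * ‖Q.s k‖ ^ 3 := by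
  have hςm := P.ςmax_pos L
  have hθ := P.θ_pos
  have hbq : 0 < b - q r := sub_pos.2 hqr
  have hr' : (0 : ℝ) < r := hr
  rcases le_or_gt ‖Q.s k‖₊ r with hs | hs
  · have hsa : ENNReal.ofReal ‖Q.s k‖ ≤ a := by
      rw [ofReal_norm, enorm_eq_nnnorm]
      exact le_trans (by exact_mod_cast hs) hra
    have hdim : Module.finrank ℝ (TangentSpace I (Q.x k)) =
        Module.finrank ℝ (TangentSpace I (R ⟨Q.x k, Q.s k⟩)) := rfl
    have h1 : b * ‖grad I f (R ⟨Q.x k, Q.s k⟩)‖ ≤ ‖gradient (pullback f R (Q.x k)) (Q.s k)‖ :=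
      mul_norm_le_of_inner_eq (A := (fiberDeriv R (Q.x k) (Q.s k)).toLinearMap) hdim hD.2.1
        (hD.2.2 k hk hsa) (fun v => hR.inner_gradient_pullback hL.1 (Q.x k) (Q.s k) v)
    have h2 := hT.2.2 k hk
    have h3 := hQ.norm_gradient_add_hessian_pullback_le hR hL hk.1
    have h4 := norm_add_le (gradient (pullback f R (Q.x k)) (Q.s k)
      - gradient (pullback f R (Q.x k)) 0 - hessian (pullback f R (Q.x k)) 0 (Q.s k))
      (gradient (pullback f R (Q.x k)) 0 + hessian (pullback f R (Q.x k)) 0 (Q.s k))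
    rw [sub_sub, sub_add_cancel, ← sub_sub] at h4
    have h5 : (q ‖Q.s k‖₊ : ℝ) * ‖grad I f (R ⟨Q.x k, Q.s k⟩)‖ ≤
        q r * ‖grad I f (R ⟨Q.x k, Q.s k⟩)‖ :=
      mul_le_mul_of_nonneg_right (by exact_mod_cast hq _ hs) (norm_nonneg _)
    have h6 := mul_lt_mul_of_pos_left hg hbq
    have h7 : ε ≤ (L' / 2 + P.θ + P.ςmax L) / (b - q r) * ‖Q.s k‖ ^ 2 := by
      rw [div_mul_eq_mul_div, le_div_iff₀ hbq]
      linarith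
    exact (one_le_rpow_mul_pow_three hε (by positivity) (norm_nonneg _) h7).trans
      (mul_le_mul_of_nonneg_right (le_max_left _ _) (by positivity))
  · have hs' : (r : ℝ) ≤ ‖Q.s k‖ := by exact_mod_cast hs.le
    refine le_trans ?_ (mul_le_mul_of_nonneg_right (le_max_right _ _) (by positivity))
    rw [one_div_mul_eq_div, le_div_iff₀ (by positivity), one_mul]
    exact pow_le_pow_left₀ hr'.le hs' 3

variable [I.Boundaryless] [IsContMDiffRiemannianBundle I ∞ E (fun x : M => TangentSpace I x)]

/-- Parallel transport is isometric, so the linearized gradient bounds the gradient at the new point.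
-/
lemma one_le_of_transportTaylorBound (hQ : Q.IsRun P f R x₀) (hR : IsRetraction R) {L : ℝ}
    (hL : Q.ScalarTaylorBound f R L) (hexp : IsExponential R) {L' : ℝ} (hL' : 0 ≤ L')
    (hT : Q.TransportTaylorBound P f R L') {ε : ℝ} (hε : 0 < ε) {k : ℕ}
    (hk : Q.Successful P f R k) (hg : ε < ‖grad I f (R ⟨Q.x k, Q.s k⟩)‖) :
    1 ≤ (L' / 2 + P.θ + P.ςmax L) ^ (1.5 : ℝ) * (1 / ε ^ (1.5 : ℝ)) * ‖Q.s k‖ ^ 3 := by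
  have hςm := P.ςmax_pos L
  have hθ := P.θ_pos
  obtain ⟨w, hw, hbound⟩ := hT k hk
  have h1 : ‖w‖ = ‖grad I f (R ⟨Q.x k, Q.s k⟩)‖ := hw.norm_eq
  have h2 := hQ.norm_gradient_add_hessian_pullback_le hR hL hk.1
  have h3 := hR.hessian_pullback_zero hexp.isSecondOrder hL.1 (Q.x k)
  rw [hR.gradient_pullback_zero hL.1, ← ContinuousLinearMap.coe_coe, h3] at h2
  have h4 := norm_add_le (w - grad I f (Q.x k) - Hess I f (Q.x k) (Q.s k))
    (grad I f (Q.x k) + Hess I f (Q.x k) (Q.s k))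
  rw [show w - grad I f (Q.x k) - Hess I f (Q.x k) (Q.s k)
    + (grad I f (Q.x k) + Hess I f (Q.x k) (Q.s k)) = w by abel] at h4
  exact one_le_rpow_mul_pow_three hε (by positivity) (norm_nonneg _) (by linarith)

end ARCSeq.IsRun

theorem mainTheorem4
    {E : Type*} [NormedAddCommGroup E] [NormedSpace ℝ E] [FiniteDimensional ℝ E]
    {H : Type*} [TopologicalSpace H] {I : ModelWithCorners ℝ E H} [I.Boundaryless]
    {M : Type*} [TopologicalSpace M] [T2Space M] [SecondCountableTopology M]
    [ChartedSpace H M] [IsManifold I ∞ M]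
    [RiemannianBundle (fun x : M => TangentSpace I x)]
    [IsContMDiffRiemannianBundle I ∞ E (fun x : M => TangentSpace I x)]
    -- cost function, lower bound, retraction, and a run of the algorithm
    (f : M → ℝ) (flow : ℝ) (hlow : ∀ x, flow ≤ f x)
    (R : TangentBundle I M → M) (hR : IsRetraction R)
    (P : ARCParams) (x₀ : M) (Q : ARCSeq I M) (hQ : Q.IsRun P f R x₀)
    (L : ℝ) (hL : Q.ScalarTaylorBound f R L)
    (εg εH : ℝ) (hεg : 0 < εg) (hεH : 0 < εH) :
    -- (a) the exponential map
    (∀ L' : ℝ, 0 ≤ L' → IsExponential R → Q.TransportTaylorBound P f R L' →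
      Q.ReachesWithin f εg εH
        (P.iterBound L (P.K₁Exp (f x₀ - flow) L L' εg) (P.K₂ (f x₀ - flow) L εH))) ∧
    -- (b) a second-order retraction
    (∀ (L' : ℝ) (q : ℝ≥0 → ℝ≥0) (a : ℝ≥0∞) (b : ℝ), 0 ≤ L' → IsSecondOrder R →
      Q.PullbackGradTaylorBound P f R L' q → Q.RetractionDerivBound P f R a b →
      ∀ r : ℝ≥0, 0 < r → (r : ℝ≥0∞) ≤ a → (q r : ℝ) < b → (∀ t ≤ r, q t ≤ q r) →
      Q.ReachesWithin f εg εH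
        (P.iterBound L (P.K₁Retr (f x₀ - flow) L L' b (q r) r εg)
          (P.K₂ (f x₀ - flow) L εH))) := by
  refine ⟨fun L' hL' hexp hT => ?_, fun L' q a b hL' hR₂ hT hD r hr hra hqr hq => ?_⟩
  · have h := hQ.reachesWithin hR hlow hL (hR.hessian_pullback_zero hexp.isSecondOrder hL.1)
      hεg hεH (κ := (L' / 2 + P.θ + P.ςmax L) ^ (1.5 : ℝ) * (1 / εg ^ (1.5 : ℝ)))
      (by have := P.ςmax_pos L; have := P.θ_pos; positivity)
      (fun k hk hg => hQ.one_le_of_transportTaylorBound hR hL hexp hL' hT hεg hk hg)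
    rwa [← mul_assoc] at h
  · exact hQ.reachesWithin hR hlow hL (hR.hessian_pullback_zero hR₂ hL.1) hεg hεH
      (le_max_of_le_right (by positivity))
      (fun k hk hg =>
        hQ.one_le_of_pullbackGradTaylorBound hR hL hL' hT hD hr hra hqr hq hεg hk hg)
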